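/- **Setting.** Let $\bar K:(0,\infty)^2\to[0,\infty)$ be continuous and symmetric. The (classical) Marcus–Lushnikov process with kernel $\bar K$ starts from a finite, possibly random, collection of clusters with masses in $(0,\infty)$; each unordered pair of clusters, of masses $x,y$, coagulates at rate $\bar K(x,y)$ (independent exponential clocks), i.e. is replaced by one cluster of mass $x+y$. For each $N\in\mathbb N$ let $\mathbf L^{(N)}_t=\sum_i\delta_{x_i(t)}$ be the point measure of the cluster masses at time $t$ of such a process, with law $\mathbb P_N$ and its own initial configuration, and let $\bar{\mathbf L}^{(N)}_t:=\tfrac1N\mathbf L^{(N)}_{t/N}$. Write $\langle g,\mu\rangle=\int g\,d\mu$ and $m(x)=x$. For a non-decreasing $\psi:\mathbb N\to\mathbb N$ with $\psi(N)\to\infty$ and $\delta>0$, put $$T_g^{\psi,\delta}:=\inf\Big\{t\ge0:\ \liminf_{N\to\infty}\mathbb P_N\big(\langle m\mathbf 1_{m\le\psi(N)},\bar{\mathbf L}^{(N)}_t\rangle\le\langle m,\bar{\mathbf L}^{(N)}_0\rangle-\delta\big)>0\Big\}.$$ *Stochastic gelation occurs* if $T_g^{\psi,\delta}<\infty$ for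 some such $\psi$ and some $\delta>0$. **Corollary 2.1.** Suppose that there is a deterministic finite measure $\bar{\mathbf L}^*_0$ on $(0,\infty)$ with $\bar{\mathbf L}^{(N)}_0\to\bar{\mathbf L}^*_0$ weakly, in probability (that is, $\langle g,\bar{\mathbf L}^{(N)}_0\rangle\to\langle g,\bar{\mathbf L}^*_0\rangle$ in probability for every bounded continuous $g$ on $(0,\infty)$), and that $\langle m\mathbf 1_{m\ge1},\bar{\mathbf L}^*_0\rangle>0$. If there is a strictly decreasing sequence $(f_j)_{j\ge0}$ in $(0,\infty)$ with $\sum_{j}f_j<\infty$ and $$\sum_{j=0}^\infty\ \sup_{x,y\in[2^j,2^{j+1})}\frac{2^j}{\bar K(x,y)f_j^2}<\infty$$ (where $1/0=\infty$), then stochastic gelation occurs. In particular, under the same assumptions on the initial data, stochastic gelation occurs in each of the following cases. 1. (a) $\inf_{i\in[1,2]}\bar K(1,i)>0$ and there are $\gamma>1$ and $R>0$ such that $\bar K(cx,cy)=c^\gamma\bar K(x,y)$ for all $x,y\ge R$ and all $c>0$. (b) $\inf_{i\in[1,2]}\bar K(1,i)>0$, $\inf_{x,y\in[2^j,2^{j+1})}\bar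 K(x,y)>0$ for every $j\ge0$, and there are $\gamma>1$ and $R>0$ such that $\bar K(x,y)=x^\gamma\bar K(1,y/x)$ for all $x,y\ge R$. 2. $\inf_{x,y\in[2^j,2^{j+1})}\bar K(x,y)>0$ for every $j\ge0$, and there are $\epsilon>0$ and $R>0$ such that $\bar K(x,y)\ge(x\wedge y)\,\big(\log(x\wedge y)\big)^{3+\epsilon}$ for all $x,y\ge R$. -/

import Mathlib

open MeasureTheory Filter Topology Set
open scoped NNReal ENNReal

noncomputable section

namespace Coagulation

/-- A coagulation kernel `K̄` of the classical model: a continuous, symmetric, nonnegative function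
of two masses in `(0, ∞)`. Values at nonpositive arguments are irrelevant. -/
structure IsKernel (K : ℝ → ℝ → ℝ) : Prop where
  continuousOn : ContinuousOn (Function.uncurry K) (Ioi 0 ×ˢ Ioi 0)
  symm : ∀ x y, 0 < x → 0 < y → K x y = K y x
  nonneg : ∀ x y, 0 < x → 0 < y → 0 ≤ K x y

/-- A configuration of labelled clusters: `x i > 0` is the mass of the cluster with label `i`, and
`x i = 0` means that there is no cluster with label `i`. -/
abbrev Configuration := ℕ → ℝ

/-- A genuine finite configuration. -/
def Configuration.IsFinite (x : Configuration) : Prop :=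
  (∀ i, 0 ≤ x i) ∧ (Function.support x).Finite

/-- The clusters labelled `p.1` and `p.2` are removed and replaced by one cluster, of mass the sum
of their masses; it gets the label `p.1`. (Used only for `p.1 < p.2`.) -/
def coagulate (x : Configuration) (p : ℕ × ℕ) : Configuration :=
  Function.update (Function.update x p.1 (x p.1 + x p.2)) p.2 0

/-- The rate `K̄(x_i, x_j)` of the exponential clock of the pair of clusters with labels `i < j`;
it is `0` if `(i, j)` is not such a pair. Every unordered pair of clusters is counted once. -/
def rate (K : ℝ → ℝ → ℝ) (x : Configuration) (p : ℕ × ℕ) : ℝ≥0∞ :=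
  open Classical in
  if p.1 < p.2 ∧ 0 < x p.1 ∧ 0 < x p.2 then ENNReal.ofReal (K (x p.1) (x p.2)) else 0

/-- The total coagulation rate of a configuration. -/
def totalRate (K : ℝ → ℝ → ℝ) (x : Configuration) : ℝ≥0∞ := ∑' p : ℕ × ℕ, rate K x p

/-- `X` is a (labelled, not yet normalised) Marcus--Lushnikov process with kernel `K` under `P`,
with an arbitrary random finite initial configuration. It is the pure jump Markov process given
by its successive configurations `Y n`, the times `S n` spent in them and the pairs `I n` of labels
that coagulate next: conditionally on the past `𝓕 n`, the time `S n` is exponential with parameter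
the total rate `q` of `Y n`, and the coagulating pair is, independently of it, `p` with
probability `rate p / q`. This is what competing independent exponential clocks, one per pair of
clusters with the rate of that pair, produce. If `q = 0` the process stays in `Y n` forever. -/
def IsMarcusLushnikov {Ω : Type*} [mΩ : MeasurableSpace Ω] (K : ℝ → ℝ → ℝ) (P : Measure Ω)
    (X : ℝ≥0 → Ω → Configuration) : Prop :=
  ∃ (𝓕 : Filtration ℕ mΩ) (Y : ℕ → Ω → Configuration) (S : ℕ → Ω → ℝ≥0∞) (I : ℕ → Ω → ℕ × ℕ),
    (∀ n, Measurable[𝓕 n] (Y n)) ∧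
    (∀ n, Measurable[𝓕 (n + 1)] (S n)) ∧
    (∀ n, Measurable[𝓕 (n + 1)] (I n)) ∧
    (∀ᵐ ω ∂P, (Y 0 ω).IsFinite) ∧
    -- the law of the next waiting time and of the next coagulating pair, given the past
    (∀ (n : ℕ) (p : ℕ × ℕ) (s : ℝ≥0) (A : Set Ω), MeasurableSet[𝓕 n] A →
      P (A ∩ {ω | (s : ℝ≥0∞) < S n ω ∧ S n ω < ∞ ∧ I n ω = p}) =
        ∫⁻ ω in A, ENNReal.ofReal (Real.exp (-((totalRate K (Y n ω)).toReal * s))) *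
          (rate K (Y n ω) p / totalRate K (Y n ω)) ∂P) ∧
    (∀ n, ∀ᵐ ω ∂P, totalRate K (Y n ω) = 0 → S n ω = ∞) ∧
    -- the transitions
    (∀ n, ∀ᵐ ω ∂P, Y (n + 1) ω = if S n ω < ∞ then coagulate (Y n ω) (I n ω) else Y n ω) ∧
    -- the process equals `Y n` between the `n`-th and the `(n + 1)`-st jump time
    (∀ᵐ ω ∂P, ∀ (n : ℕ) (t : ℝ≥0), ∑ k ∈ Finset.range n, S k ω ≤ (t : ℝ≥0∞) →
      (t : ℝ≥0∞) < ∑ k ∈ Finset.range (n + 1), S k ω → X t ω = Y n ω)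

/-- The point measure of a configuration: a unit mass at the mass of each of its clusters. It is
concentrated on `(0, ∞)`. -/
def pointMeasure (x : Configuration) : Measure ℝ :=
  open Classical in
  Measure.sum fun i => if 0 < x i then Measure.dirac (x i) else 0

/-- The normalised process `t ↦ L_{t / N} / N`, where `L_t` is the point measure of `X t`. -/
def normalized {Ω : Type*} (N : ℕ) (X : ℝ≥0 → Ω → Configuration) (t : ℝ≥0) (ω : Ω) : Measure ℝ :=
  (N : ℝ≥0∞)⁻¹ • pointMeasure (X (t / N) ω)

/-- Random measures `L N` on `(0, ∞)` converge weakly, in probability, to the deterministic `μ`: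
for every bounded continuous function `f` on `(0, ∞)`, the integrals of `f` converge in
probability. -/
def TendstoWeaklyInProbability {Ω : ℕ → Type*} [∀ N, MeasurableSpace (Ω N)]
    (P : ∀ N, Measure (Ω N)) (L : ∀ N, Ω N → Measure ℝ) (μ : Measure ℝ) : Prop :=
  ∀ f : ℝ → ℝ, ContinuousOn f (Ioi 0) → (∃ C, ∀ x, 0 < x → |f x| ≤ C) →
    ∀ η : ℝ, 0 < η →
      Tendsto (fun N => P N {ω | η ≤ |∫ x in Ioi 0, f x ∂(L N ω) - ∫ x in Ioi 0, f x ∂μ|})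
        atTop (𝓝 0)

/-- The mass `⟨m 1_{m ≥ 1}, μ⟩` carried by the clusters of mass at least `1`, where `m x = x`. -/
def massGeOne (μ : Measure ℝ) : ℝ≥0∞ := ∫⁻ x in Ici 1, ENNReal.ofReal x ∂μ

/-- The `(ψ, δ)`-stochastic gelation time (`∞` if there is no admissible time). -/
def stochasticGelationTime {Ω : ℕ → Type*} [∀ N, MeasurableSpace (Ω N)]
    (P : ∀ N, Measure (Ω N)) (L : ∀ N, ℝ≥0 → Ω N → Measure ℝ) (ψ : ℕ → ℕ) (δ : ℝ) : ℝ≥0∞ :=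
  sInf ((fun t : ℝ≥0 => (t : ℝ≥0∞)) '' {t : ℝ≥0 |
    0 < liminf (fun N => P N {ω |
      ∫ x in Iic (ψ N : ℝ), x ∂(L N t ω) ≤ ∫ x, x ∂(L N 0 ω) - δ}) atTop})

/-- Stochastic gelation occurs. -/
def StochasticGelation {Ω : ℕ → Type*} [∀ N, MeasurableSpace (Ω N)]
    (P : ∀ N, Measure (Ω N)) (L : ∀ N, ℝ≥0 → Ω N → Measure ℝ) : Prop :=
  ∃ ψ : ℕ → ℕ, Monotone ψ ∧ Tendsto ψ atTop atTop ∧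
    ∃ δ : ℝ, 0 < δ ∧ stochasticGelationTime P L ψ δ < ∞

/-- The dyadic block `[2^j, 2^{j+1})`. -/
def block (j : ℕ) : Set ℝ := Ico (2 ^ j) (2 ^ (j + 1))

/-- The infimum of the kernel over pairs of masses in the `j`-th dyadic block. -/
def blockInf (K : ℝ → ℝ → ℝ) (j : ℕ) : ℝ := ⨅ p : ↥(block j ×ˢ block j), K p.1.1 p.1.2

end Coagulation

end

namespace Coagulation

/-! Mass is pushed up a ladder of levels `θ j`, and the expected delay at each rung is summable. The
mass above any fixed level never decreases in time. Give level `j` the target `N * a j`, where `a j`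
decreases from `A` by the steps `c * f j` and never falls below `A / 2`. If the target of level `0`
is met initially but that of level `J` is still missed at some time, then at every earlier moment
some `j < J` is a bottleneck: target `j` is met and target `j + 1` is missed.

At a bottleneck the clusters in `[θ j, θ (j + 1))` carry mass at least `N * c * f j`, so they are
numerous and their pairs coagulate at rate at least `κ j * (N * c * f j) ^ 2 / (4 * θ (j + 1) ^ 2)`.
Each such coagulation lifts mass at least `2 * θ j` above level `j + 1`, which bounds their number
while target `j + 1` is missed. Number divided by rate bounds the expected time at this bottleneck
by a constant times `θ j / (N * κ j * f j ^ 2)` (`occupation_le`, `occupation_level_le`). Summing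
over `j` and applying Markov's inequality (`mul_measure_massAbove_lt_le`), with high probability a
fixed share of the mass lies above level `J N` at a time of order `1 / N`. Here `J N` tends to
infinity, and by conservation of mass this share is missing from the small clusters
(`stochasticGelation_of_levels`).

The levels are the powers of two, preceded by one level `ζ < 1`, because weak convergence may let
the mass that the limit has at `1` be approached from below. The special kernels follow by choosing
`f` geometric or a power of `j + 1`. -/

/-! ### Configurations: mass above a level and coagulation rates. -/

theorem tsum_coagulate (g : ℝ → ℝ≥0∞) (hg : g 0 = 0) (x : Configuration) {i j : ℕ}
    (hij : i ≠ j) :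
    (∑' k, g (coagulate x (i, j) k)) + (g (x i) + g (x j)) = (∑' k, g (x k)) + g (x i + x j) := by
  classical
  have h : ∀ y : Configuration, ∑' k, g (y k) =
      g (y i) + (g (y j) + ∑' k, if k = j then 0 else if k = i then 0 else g (y k)) := by
    intro y
    rw [ENNReal.tsum_eq_add_tsum_ite i, ENNReal.tsum_eq_add_tsum_ite j]
    simp only [hij.symm, if_false]
    congr! 5
    split_ifs <;> rfl
  rw [h (coagulate x (i, j)), h x]
  have h1 : coagulate x (i, j) i = x i + x j := by simp [coagulate, hij]
  have h2 : coagulate x (i, j) j = 0 := by simp [coagulate]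
  have h3 : ∀ k, (if k = j then 0 else if k = i then 0 else g (coagulate x (i, j) k)) =
      if k = j then 0 else if k = i then 0 else g (x k) := by
    intro k
    by_cases hkj : k = j
    · simp [hkj]
    · by_cases hki : k = i
      · simp [hki]
      · simp [coagulate, hkj, hki]
  rw [h1, h2, hg, tsum_congr h3]
  ring

theorem Configuration.IsFinite.tsum_ne_top {x : Configuration} (hx : x.IsFinite)
    {g : ℝ → ℝ≥0∞} (hg : g 0 = 0) (hg' : ∀ v, g v ≠ ∞) : ∑' k, g (x k) ≠ ∞ := by
  rw [tsum_eq_sum (s := hx.2.toFinset)]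
  · exact ENNReal.sum_ne_top.2 fun k _ => hg' _
  · intro k hk
    simp only [Finite.mem_toFinset, Function.mem_support, not_not] at hk
    rw [hk, hg]

theorem Configuration.IsFinite.coagulate {x : Configuration} (hx : x.IsFinite) (p : ℕ × ℕ) :
    Configuration.IsFinite (Coagulation.coagulate x p) := by
  refine ⟨fun i => ?_, (hx.2.union (Set.toFinite {p.1, p.2})).subset fun i hi => ?_⟩
  · simp only [Coagulation.coagulate, Function.update_apply]
    split_ifs
    · exact le_rfl
    · exact add_nonneg (hx.1 _) (hx.1 _)
    · exact hx.1 _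
  · by_contra h
    simp only [mem_union, Function.mem_support, mem_insert_iff, mem_singleton_iff, not_or,
      not_not] at h
    apply hi
    simp [Coagulation.coagulate, h.1, h.2.1, h.2.2]

/-- The mass carried by the clusters of mass at least `θ`. -/
noncomputable def massAbove (θ : ℝ) (x : Configuration) : ℝ≥0∞ :=
  ∑' i, (Ici θ).indicator ENNReal.ofReal (x i)

theorem indicator_Ici_zero (θ : ℝ) : (Ici θ).indicator ENNReal.ofReal 0 = 0 := by
  simp [indicator_apply]

theorem indicator_Ici_ne_top (θ v : ℝ) : (Ici θ).indicator ENNReal.ofReal v ≠ ∞ := by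
  rw [indicator_apply]; split_ifs <;> simp

theorem Configuration.IsFinite.massAbove_ne_top {x : Configuration} (hx : x.IsFinite) (θ : ℝ) :
    massAbove θ x ≠ ∞ :=
  hx.tsum_ne_top (indicator_Ici_zero θ) (indicator_Ici_ne_top θ)

theorem measurable_massAbove (θ : ℝ) : Measurable (massAbove θ) :=
  Measurable.tsum fun i =>
    (ENNReal.measurable_ofReal.indicator measurableSet_Ici).comp (measurable_pi_apply i)

theorem massAbove_zero_coagulate {x : Configuration} (hx : x.IsFinite) {p : ℕ × ℕ}
    (hp : p.1 < p.2) : massAbove 0 (coagulate x p) = massAbove 0 x := by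
  have h := tsum_coagulate _ (indicator_Ici_zero 0) x hp.ne
  have h1 := hx.1 p.1
  have h2 := hx.1 p.2
  have e : (Ici (0 : ℝ)).indicator ENNReal.ofReal (x p.1 + x p.2) =
      (Ici (0 : ℝ)).indicator ENNReal.ofReal (x p.1) +
        (Ici (0 : ℝ)).indicator ENNReal.ofReal (x p.2) := by
    rw [indicator_of_mem (mem_Ici.2 h1), indicator_of_mem (mem_Ici.2 h2),
      indicator_of_mem (mem_Ici.2 (add_nonneg h1 h2)), ENNReal.ofReal_add h1 h2]
  rw [e] at h
  exact (ENNReal.add_left_inj (by simp [indicator_Ici_ne_top])).1 h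

/-- The function equal to `v` for `v ≥ θ` and to `0` below `θ` is superadditive on `[0, ∞)`. -/
theorem massAbove_le_coagulate {x : Configuration} (hx : x.IsFinite) {p : ℕ × ℕ}
    (hp : p.1 < p.2) (θ : ℝ) : massAbove θ x ≤ massAbove θ (coagulate x p) := by
  have h := tsum_coagulate _ (indicator_Ici_zero θ) x hp.ne
  have h1 := hx.1 p.1
  have h2 := hx.1 p.2
  have e : (Ici θ).indicator ENNReal.ofReal (x p.1) + (Ici θ).indicator ENNReal.ofReal (x p.2) ≤
      (Ici θ).indicator ENNReal.ofReal (x p.1 + x p.2) := by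
    simp only [indicator_apply, mem_Ici]
    split_ifs with a b c c b c c
    · rw [ENNReal.ofReal_add h1 h2]
    · linarith
    · simpa using ENNReal.ofReal_le_ofReal (by linarith)
    · linarith
    · simpa using ENNReal.ofReal_le_ofReal (by linarith)
    · linarith
    · simp
    · simp
  refine ENNReal.le_of_add_le_add_right (a := (Ici θ).indicator ENNReal.ofReal (x p.1) +
    (Ici θ).indicator ENNReal.ofReal (x p.2)) (by simp [indicator_Ici_ne_top]) ?_
  exact (add_le_add_right e _).trans h.ge

/-- A coagulation of two clusters with masses in `[θ, θ')` adds their mass to the clusters of mass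
at least `θ'`. -/
theorem massAbove_add_le_coagulate {x : Configuration} {p : ℕ × ℕ} (hp : p.1 < p.2) {θ θ' : ℝ}
    (hθ : θ' ≤ 2 * θ) (h1 : x p.1 ∈ Ico θ θ') (h2 : x p.2 ∈ Ico θ θ') :
    massAbove θ' x + ENNReal.ofReal (2 * θ) ≤ massAbove θ' (coagulate x p) := by
  have h := tsum_coagulate _ (indicator_Ici_zero θ') x hp.ne
  rw [indicator_of_notMem (a := x p.1) (by simpa using h1.2),
    indicator_of_notMem (a := x p.2) (by simpa using h2.2),
    indicator_of_mem (a := x p.1 + x p.2) (by simp only [mem_Ici]; linarith [h1.1, h2.1])] at h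
  simp only [add_zero] at h
  refine le_trans ?_ h.ge
  exact add_le_add_right (ENNReal.ofReal_le_ofReal (by linarith [h1.1, h2.1])) _

theorem massAbove_add_low_le {θ b : ℝ} (hb : b < θ) (x : Configuration) :
    massAbove θ x + ∑' i, (Ioc 0 b).indicator ENNReal.ofReal (x i) ≤ massAbove 0 x := by
  rw [massAbove, massAbove, ← ENNReal.tsum_add]
  refine ENNReal.tsum_le_tsum fun i => ?_
  simp only [indicator_apply, mem_Ici, mem_Ioc]
  split_ifs with a b c c b c c
  · linarith
  · linarith
  · simp
  · have : x i ≤ 0 := by linarith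
    simp [this]
  · simp
  · linarith
  · simp
  · simp

/-- The labels of the clusters with mass in `[θ, θ')`. -/
noncomputable def Configuration.IsFinite.labels {x : Configuration} (hx : x.IsFinite)
    (θ θ' : ℝ) : Finset ℕ :=
  open Classical in hx.2.toFinset.filter fun i => x i ∈ Ico θ θ'

theorem Configuration.IsFinite.mem_labels {x : Configuration} (hx : x.IsFinite)
    {θ θ' : ℝ} (hθ : 0 < θ) {i : ℕ} : i ∈ hx.labels θ θ' ↔ x i ∈ Ico θ θ' := by
  simp only [labels, Finset.mem_filter, Finite.mem_toFinset, Function.mem_support,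
    and_iff_right_iff_imp]
  intro h
  exact (hθ.trans_le h.1).ne'

theorem massAbove_le_add_card {x : Configuration} (hx : x.IsFinite) {θ θ' : ℝ} (hθ : 0 < θ) :
    massAbove θ x ≤ massAbove θ' x + ENNReal.ofReal ((hx.labels θ θ').card * θ') := by
  classical
  have h : massAbove θ x ≤ massAbove θ' x +
      ∑' i, if i ∈ hx.labels θ θ' then ENNReal.ofReal θ' else 0 := by
    rw [massAbove, massAbove, ← ENNReal.tsum_add]
    refine ENNReal.tsum_le_tsum fun i => ?_
    simp only [hx.mem_labels hθ, indicator_apply, mem_Ici, mem_Ico]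
    split_ifs with a b c c b c c
    · simp
    · simp
    · simpa using ENNReal.ofReal_le_ofReal c.2.le
    · exact absurd ⟨a, not_le.1 b⟩ c
    all_goals simp
  refine h.trans (add_le_add_right (le_of_eq ?_) _)
  rw [tsum_eq_sum (s := hx.labels θ θ') (by intro b hb; simp [hb]),
    Finset.sum_congr rfl (fun i hi => if_pos hi), Finset.sum_const, nsmul_eq_mul,
    ENNReal.ofReal_mul (by positivity), ENNReal.ofReal_natCast]

theorem card_offDiag_filter_lt (s : Finset ℕ) :
    2 * (s.offDiag.filter fun p => p.1 < p.2).card = s.card * s.card - s.card := by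
  rw [← Finset.offDiag_card, two_mul]
  have h := Finset.card_filter_add_card_filter_not (s := s.offDiag) (fun p => p.1 < p.2)
  rw [← h]
  congr 1
  refine Finset.card_bij (fun p _ => p.swap) ?_ ?_ ?_
  · rintro ⟨a, b⟩ h
    simp only [Finset.mem_filter, Finset.mem_offDiag, Prod.swap] at h ⊢
    exact ⟨⟨h.1.2.1, h.1.1, h.1.2.2.symm⟩, by omega⟩
  · rintro ⟨a, b⟩ _ ⟨c, d⟩ _ h
    simpa [and_comm] using h
  · rintro ⟨a, b⟩ h
    refine ⟨(b, a), ?_, rfl⟩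
    simp only [Finset.mem_filter, Finset.mem_offDiag] at h ⊢
    exact ⟨⟨h.1.2.1, h.1.1, h.1.2.2.symm⟩, by omega⟩

/-- The labels of a pair of clusters with masses in `[θ, θ')`. -/
def IsPairIn (θ θ' : ℝ) (x : Configuration) (p : ℕ × ℕ) : Prop :=
  p.1 < p.2 ∧ x p.1 ∈ Ico θ θ' ∧ x p.2 ∈ Ico θ θ'

open Classical in
/-- The total rate at which pairs of clusters with masses in `[θ, θ')` coagulate. -/
noncomputable def pairRate (K : ℝ → ℝ → ℝ) (θ θ' : ℝ) (x : Configuration) : ℝ≥0∞ :=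
  ∑' p : ℕ × ℕ, if IsPairIn θ θ' x p then rate K x p else 0

theorem pairRate_le_totalRate (K : ℝ → ℝ → ℝ) (θ θ' : ℝ) (x : Configuration) :
    pairRate K θ θ' x ≤ totalRate K x :=
  ENNReal.tsum_le_tsum fun p => by split_ifs <;> simp

/-- Mass `F` in clusters lighter than `θ'` needs `n ≥ F / θ'` clusters. The hypothesis `2 * θ' ≤ F`
makes `n ≥ 2`, so the number of pairs `n (n - 1) / 2` is at least `n ^ 2 / 4`. -/
theorem le_pairRate {K : ℝ → ℝ → ℝ} {x : Configuration} (hx : x.IsFinite) {θ θ' κ F : ℝ}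
    (hθ : 0 < θ) (hθ' : θ ≤ θ') (hκ : 0 ≤ κ)
    (hK : ∀ u ∈ Ico θ θ', ∀ v ∈ Ico θ θ', κ ≤ K u v) (hF : 2 * θ' ≤ F)
    (hmass : massAbove θ' x + ENNReal.ofReal F ≤ massAbove θ x) :
    ENNReal.ofReal (κ * F ^ 2 / (4 * θ' ^ 2)) ≤ pairRate K θ θ' x := by
  classical
  set s := hx.labels θ θ' with hs
  have hθ0 : 0 < θ' := hθ.trans_le hθ'
  have h1 : F ≤ s.card * θ' := by
    have h := hmass.trans (massAbove_le_add_card (θ' := θ') hx hθ)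
    have h := ENNReal.le_of_add_le_add_left (hx.massAbove_ne_top θ') h
    exact (ENNReal.ofReal_le_ofReal_iff (by positivity)).1 h
  have h2 : (2 : ℝ) ≤ s.card := by
    by_contra! h
    nlinarith
  have hcard : F ^ 2 / (4 * θ' ^ 2) ≤ ((s.offDiag.filter fun p => p.1 < p.2).card : ℝ) := by
    have h := card_offDiag_filter_lt s
    have hle : s.card ≤ s.card * s.card := Nat.le_mul_self _
    have h' : (2 : ℝ) * (s.offDiag.filter fun p => p.1 < p.2).card =
        s.card * s.card - s.card := by
      rw [← Nat.cast_mul s.card, ← Nat.cast_sub hle, ← h]; push_cast; rfl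
    rw [div_le_iff₀ (by positivity)]
    have h3 : F ^ 2 ≤ (s.card * θ') ^ 2 := by
      apply pow_le_pow_left₀ _ h1
      linarith
    nlinarith [sq_nonneg θ', mul_nonneg (sq_nonneg θ') (by nlinarith :
      (0 : ℝ) ≤ s.card * s.card - 2 * s.card)]
  calc ENNReal.ofReal (κ * F ^ 2 / (4 * θ' ^ 2))
      ≤ ENNReal.ofReal (((s.offDiag.filter fun p => p.1 < p.2).card : ℝ) * κ) := by
        apply ENNReal.ofReal_le_ofReal
        rw [mul_div_assoc, mul_comm]
        exact mul_le_mul_of_nonneg_right hcard hκ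
    _ = ∑ p ∈ s.offDiag.filter fun p => p.1 < p.2, ENNReal.ofReal κ := by
        rw [Finset.sum_const, nsmul_eq_mul, ENNReal.ofReal_mul (by positivity),
          ENNReal.ofReal_natCast]
    _ ≤ ∑ p ∈ s.offDiag.filter fun p => p.1 < p.2,
          if IsPairIn θ θ' x p then rate K x p else 0 := by
        refine Finset.sum_le_sum fun p hp => ?_
        simp only [Finset.mem_filter, Finset.mem_offDiag, hs, hx.mem_labels hθ] at hp
        rw [if_pos ⟨hp.2, hp.1.1, hp.1.2.1⟩, rate,
          if_pos ⟨hp.2, hθ.trans_le hp.1.1.1, hθ.trans_le hp.1.2.1.1⟩]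
        exact ENNReal.ofReal_le_ofReal (hK _ hp.1.1 _ hp.1.2.1)
    _ ≤ pairRate K θ θ' x := ENNReal.sum_le_tsum _

theorem Configuration.IsFinite.totalRate_ne_top {x : Configuration} (hx : x.IsFinite)
    (K : ℝ → ℝ → ℝ) : totalRate K x ≠ ∞ := by
  rw [totalRate, tsum_eq_sum (s := hx.2.toFinset ×ˢ hx.2.toFinset)]
  · refine ENNReal.sum_ne_top.2 fun k _ => ?_
    rw [rate]; split_ifs <;> simp
  · intro p hp
    rw [rate, if_neg]
    rintro ⟨-, h1, h2⟩
    apply hp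
    simp [h1.ne', h2.ne']

theorem pos_of_rate_ne_zero {K : ℝ → ℝ → ℝ} {x : Configuration} {p : ℕ × ℕ}
    (h : rate K x p ≠ 0) : p.1 < p.2 ∧ 0 < x p.1 ∧ 0 < x p.2 := by
  by_contra hn
  exact h (if_neg hn)

theorem IsKernel.measurable_rate {K : ℝ → ℝ → ℝ} (hK : IsKernel K) (p : ℕ × ℕ) :
    Measurable fun x : Configuration => rate K x p := by
  classical
  have hm : MeasurableSet (Ioi (0 : ℝ) ×ˢ Ioi (0 : ℝ)) := measurableSet_Ioi.prod measurableSet_Ioi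
  -- The kernel is controlled only on the open quadrant, so its extension by `0` replaces it.
  have h : Measurable ((Ioi (0 : ℝ) ×ˢ Ioi (0 : ℝ)).piecewise (Function.uncurry K) 0) :=
    hK.continuousOn.measurable_piecewise continuousOn_const hm
  by_cases hp : p.1 < p.2
  · have h2 : Measurable fun x : Configuration => (x p.1, x p.2) := by fun_prop
    convert ENNReal.measurable_ofReal.comp (h.comp h2) using 1
    ext x
    simp only [rate, hp, true_and, Function.comp, piecewise, mem_prod, mem_Ioi]
    split_ifs <;> simp
  · simp [rate, hp]

theorem IsKernel.measurable_totalRate {K : ℝ → ℝ → ℝ} (hK : IsKernel K) :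
    Measurable (totalRate K) :=
  Measurable.tsum fun p => hK.measurable_rate p

theorem measurableSet_isPairIn (θ θ' : ℝ) (p : ℕ × ℕ) :
    MeasurableSet {x : Configuration | IsPairIn θ θ' x p} := by
  have h (i : ℕ) : MeasurableSet {x : Configuration | x i ∈ Ico θ θ'} :=
    measurable_pi_apply i measurableSet_Ico
  exact (MeasurableSet.const _).inter ((h _).inter (h _))

theorem Configuration.IsFinite.card_support_coagulate_lt {x : Configuration} (hx : x.IsFinite)
    {p : ℕ × ℕ} (h1 : 0 < x p.1) (h2 : 0 < x p.2) :
    (Function.support (Coagulation.coagulate x p)).ncard < (Function.support x).ncard := by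
  refine ncard_lt_ncard ⟨fun i hi => ?_, fun h => ?_⟩ hx.2
  · simp only [Coagulation.coagulate, Function.mem_support, Function.update_apply] at hi
    split_ifs at hi with h h'
    · exact absurd rfl hi
    · rw [h']; exact h1.ne'
    · exact hi
  · exact h (a := p.2) h2.ne' (by simp [Coagulation.coagulate])

theorem lintegral_pointMeasure (x : Configuration) {g : ℝ → ℝ≥0∞} (hg : Measurable g) :
    ∫⁻ v, g v ∂(pointMeasure x) = ∑' i, (Ioi 0).indicator g (x i) := by
  rw [pointMeasure, lintegral_sum_measure]
  refine tsum_congr fun i => ?_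
  simp only [indicator_apply, mem_Ioi]
  split_ifs
  · rw [lintegral_dirac' _ hg]
  · simp

theorem pointMeasure_Iic_zero (x : Configuration) : pointMeasure x (Iic 0) = 0 := by
  rw [← lintegral_indicator_one measurableSet_Iic,
    lintegral_pointMeasure x (measurable_one.indicator measurableSet_Iic), ENNReal.tsum_eq_zero]
  intro i
  simp only [indicator_apply, mem_Ioi, mem_Iic]
  split_ifs <;> first | rfl | linarith

/-! ### Pathwise properties of trajectories. -/

/-- The successive configurations, waiting times and coagulating pairs of a trajectory of a
Marcus--Lushnikov process. -/
structure IsJumpPath (K : ℝ → ℝ → ℝ) (y : ℕ → Configuration) (s : ℕ → ℝ≥0∞) (i : ℕ → ℕ × ℕ) :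
    Prop where
  isFinite : ∀ n, (y n).IsFinite
  pos : ∀ n, 0 < s n
  rate_ne_zero : ∀ n, s n < ∞ → rate K (y n) (i n) ≠ 0
  step : ∀ n, y (n + 1) = if s n < ∞ then coagulate (y n) (i n) else y n

namespace IsJumpPath

variable {K : ℝ → ℝ → ℝ} {y : ℕ → Configuration} {s : ℕ → ℝ≥0∞} {i : ℕ → ℕ × ℕ}

theorem massAbove_mono (h : IsJumpPath K y s i) (θ : ℝ) : Monotone fun n => massAbove θ (y n) := by
  refine monotone_nat_of_le_succ fun n => ?_
  rw [h.step n]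
  split_ifs with hs
  · exact massAbove_le_coagulate (h.isFinite n) (pos_of_rate_ne_zero (h.rate_ne_zero n hs)).1 θ
  · exact le_rfl

theorem massAbove_zero_eq (h : IsJumpPath K y s i) (n : ℕ) :
    massAbove 0 (y n) = massAbove 0 (y 0) := by
  induction n with
  | zero => rfl
  | succ n ih =>
    rw [← ih, h.step n]
    split_ifs with hs
    · exact massAbove_zero_coagulate (h.isFinite n) (pos_of_rate_ne_zero (h.rate_ne_zero n hs)).1
    · rfl

/-- Every jump lowers the number of clusters, so there are finitely many jumps. This excludes
explosion. -/
theorem exists_eq_top (h : IsJumpPath K y s i) : ∃ n, s n = ∞ := by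
  by_contra! hs
  have key : ∀ n, (Function.support (y n)).ncard + n ≤ (Function.support (y 0)).ncard := by
    intro n
    induction n with
    | zero => simp
    | succ n ih =>
      have h1 := h.rate_ne_zero n (hs n).lt_top
      have h2 := h.step n
      rw [if_pos (hs n).lt_top] at h2
      have h3 := (h.isFinite n).card_support_coagulate_lt (pos_of_rate_ne_zero h1).2.1
        (pos_of_rate_ne_zero h1).2.2
      rw [← h2] at h3
      omega
  have := key ((Function.support (y 0)).ncard + 1)
  omega

theorem exists_sum_le_lt (h : IsJumpPath K y s i) (t : ℝ≥0) :
    ∃ n, ∑ k ∈ Finset.range n, s k ≤ t ∧ (t : ℝ≥0∞) < ∑ k ∈ Finset.range (n + 1), s k := by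
  classical
  have hex : ∃ n, (t : ℝ≥0∞) < ∑ k ∈ Finset.range (n + 1), s k := by
    obtain ⟨n, hn⟩ := h.exists_eq_top
    refine ⟨n, ?_⟩
    rw [Finset.sum_range_succ, hn, add_top]
    exact ENNReal.coe_lt_top
  refine ⟨Nat.find hex, ?_, Nat.find_spec hex⟩
  rcases hn : Nat.find hex with _ | m
  · simp
  · exact not_lt.1 (Nat.find_min hex (m := m) (by omega))

open Classical in
/-- The number of coagulations of two clusters with masses in `[θ, θ')` that happen while the
clusters of mass at least `θ'` carry a mass less than `a` is at most `a / (2 θ) + 1`. -/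
theorem tsum_pair_le (h : IsJumpPath K y s i) {θ θ' : ℝ} (hθ : θ' ≤ 2 * θ) (a : ℝ≥0∞) :
    ∑' n, (if massAbove θ' (y n) < a ∧ s n < ∞ ∧ IsPairIn θ θ' (y n) (i n) then
      ENNReal.ofReal (2 * θ) else 0) ≤ a + ENNReal.ofReal (2 * θ) := by
  refine ENNReal.tsum_le_of_sum_range_le fun n => ?_
  -- Both bounds go through the induction together: the partial sum stays below the mass above `θ'`,
  -- and a new term is counted only while that mass is below `a`, so `a` is overshot by at most one
  -- term.
  suffices H : (∑ k ∈ Finset.range n, if massAbove θ' (y k) < a ∧ s k < ∞ ∧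
      IsPairIn θ θ' (y k) (i k) then ENNReal.ofReal (2 * θ) else 0) ≤ massAbove θ' (y n) ∧
      (∑ k ∈ Finset.range n, if massAbove θ' (y k) < a ∧ s k < ∞ ∧
      IsPairIn θ θ' (y k) (i k) then ENNReal.ofReal (2 * θ) else 0) ≤
        a + ENNReal.ofReal (2 * θ) from H.2
  induction n with
  | zero => simp
  | succ n ih =>
    rw [Finset.sum_range_succ]
    split_ifs with hn
    · refine ⟨?_, by gcongr; exact ih.1.trans hn.1.le⟩
      rw [h.step n, if_pos hn.2.1]
      exact (add_le_add_left ih.1 _).trans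
        (massAbove_add_le_coagulate hn.2.2.1 hθ hn.2.2.2.1 hn.2.2.2.2)
    · rw [add_zero]
      exact ⟨ih.1.trans (h.massAbove_mono θ' n.le_succ), ih.2⟩

end IsJumpPath

/-! ### The jump chain: waiting times and expected occupation times. -/

/-- The jump chain of a Marcus--Lushnikov process, with its waiting times and coagulating pairs. -/
structure IsJumpChain {Ω : Type*} [mΩ : MeasurableSpace Ω] (K : ℝ → ℝ → ℝ) (P : Measure Ω)
    (𝓕 : Filtration ℕ mΩ) (Y : ℕ → Ω → Configuration) (S : ℕ → Ω → ℝ≥0∞) (I : ℕ → Ω → ℕ × ℕ) :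
    Prop where
  adapted : ∀ n, Measurable[𝓕 n] (Y n)
  measurable_time : ∀ n, Measurable[𝓕 (n + 1)] (S n)
  measurable_pair : ∀ n, Measurable[𝓕 (n + 1)] (I n)
  init : ∀ᵐ ω ∂P, (Y 0 ω).IsFinite
  law : ∀ (n : ℕ) (p : ℕ × ℕ) (s : ℝ≥0) (A : Set Ω), MeasurableSet[𝓕 n] A →
      P (A ∩ {ω | (s : ℝ≥0∞) < S n ω ∧ S n ω < ∞ ∧ I n ω = p}) =
        ∫⁻ ω in A, ENNReal.ofReal (Real.exp (-((totalRate K (Y n ω)).toReal * s))) *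
          (rate K (Y n ω) p / totalRate K (Y n ω)) ∂P
  absorbed : ∀ n, ∀ᵐ ω ∂P, totalRate K (Y n ω) = 0 → S n ω = ∞
  step : ∀ n, ∀ᵐ ω ∂P, Y (n + 1) ω = if S n ω < ∞ then coagulate (Y n ω) (I n ω) else Y n ω

namespace IsJumpChain

variable {Ω : Type*} [mΩ : MeasurableSpace Ω] {K : ℝ → ℝ → ℝ} {P : Measure Ω}
  {𝓕 : Filtration ℕ mΩ} {Y : ℕ → Ω → Configuration} {S : ℕ → Ω → ℝ≥0∞} {I : ℕ → Ω → ℕ × ℕ}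

theorem measurable_S (h : IsJumpChain K P 𝓕 Y S I) (n : ℕ) : Measurable (S n) :=
  (h.measurable_time n).mono (𝓕.le _) le_rfl

theorem measurable_I (h : IsJumpChain K P 𝓕 Y S I) (n : ℕ) : Measurable (I n) :=
  (h.measurable_pair n).mono (𝓕.le _) le_rfl

theorem measurable_Y (h : IsJumpChain K P 𝓕 Y S I) (n : ℕ) : Measurable (Y n) :=
  (h.adapted n).mono (𝓕.le _) le_rfl

theorem ae_isFinite (h : IsJumpChain K P 𝓕 Y S I) : ∀ᵐ ω ∂P, ∀ n, (Y n ω).IsFinite := by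
  filter_upwards [h.init, ae_all_iff.2 h.step] with ω h0 hs n
  induction n with
  | zero => exact h0
  | succ n ih =>
    rw [hs n]
    split_ifs
    · exact ih.coagulate _
    · exact ih

theorem measurableSet_event (h : IsJumpChain K P 𝓕 Y S I) (n : ℕ) (s : ℝ≥0) (p : ℕ × ℕ) :
    MeasurableSet {ω | (s : ℝ≥0∞) < S n ω ∧ S n ω < ∞ ∧ I n ω = p} :=
  (measurableSet_lt measurable_const (h.measurable_S n)).inter
    ((measurableSet_lt (h.measurable_S n) measurable_const).inter
      (h.measurable_I n (measurableSet_singleton p)))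

theorem measure_inter_lt (hK : IsKernel K) (h : IsJumpChain K P 𝓕 Y S I) {n : ℕ} {A : Set Ω}
    (hA : MeasurableSet[𝓕 n] A) (hA0 : ∀ ω ∈ A, totalRate K (Y n ω) ≠ 0) (s : ℝ≥0) :
    P (A ∩ {ω | (s : ℝ≥0∞) < S n ω ∧ S n ω < ∞}) =
      ∫⁻ ω in A, ENNReal.ofReal (Real.exp (-((totalRate K (Y n ω)).toReal * s))) ∂P := by
  have e : A ∩ {ω | (s : ℝ≥0∞) < S n ω ∧ S n ω < ∞} =
      ⋃ p, A ∩ {ω | (s : ℝ≥0∞) < S n ω ∧ S n ω < ∞ ∧ I n ω = p} := by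
    ext ω; simp
  have hq := hK.measurable_totalRate.comp (h.measurable_Y n)
  have hA' : MeasurableSet A := 𝓕.le n _ hA
  rw [e, measure_iUnion, tsum_congr fun p => h.law n p s A hA, ← lintegral_tsum]
  · refine setLIntegral_congr_fun_ae hA' ?_
    filter_upwards [h.ae_isFinite] with ω hf hω
    have : ∑' p, rate K (Y n ω) p / totalRate K (Y n ω) = 1 := by
      simp only [div_eq_mul_inv]
      rw [ENNReal.tsum_mul_right]
      exact ENNReal.mul_inv_cancel (hA0 ω hω) ((hf n).totalRate_ne_top K)
    rw [ENNReal.tsum_mul_left, this, mul_one]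
  · intro p
    have hr := (hK.measurable_rate p).comp (h.measurable_Y n)
    simp only [Function.comp_def] at hq hr
    fun_prop
  · intro p q hpq
    refine disjoint_left.2 ?_
    rintro ω ⟨-, -, -, h1⟩ ⟨-, -, -, h2⟩
    exact hpq (h1.symm.trans h2)
  · exact fun p => hA'.inter (h.measurableSet_event n s p)

theorem measurableSet_totalRate_ne_zero (hK : IsKernel K) (h : IsJumpChain K P 𝓕 Y S I) (n : ℕ) :
    MeasurableSet[𝓕 n] {ω | totalRate K (Y n ω) ≠ 0} :=
  (hK.measurable_totalRate.comp (h.adapted n)) (measurableSet_singleton 0).compl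

/-- At `s = 0` the exponential tail is `1`, so `{0 < S n < ∞}` fills the whole event of positive
total rate, up to a null set. -/
theorem ae_pos_lt_top [IsFiniteMeasure P] (hK : IsKernel K) (h : IsJumpChain K P 𝓕 Y S I)
    (n : ℕ) : ∀ᵐ ω ∂P, totalRate K (Y n ω) ≠ 0 → 0 < S n ω ∧ S n ω < ∞ := by
  set A := {ω | totalRate K (Y n ω) ≠ 0} with hAdef
  have hA := h.measurableSet_totalRate_ne_zero hK n
  have h1 := h.measure_inter_lt hK hA (fun ω hω => hω) 0
  simp only [NNReal.coe_zero, mul_zero, neg_zero, Real.exp_zero, ENNReal.ofReal_one,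
    lintegral_one, Measure.restrict_apply_univ, ENNReal.coe_zero] at h1
  have hm : MeasurableSet {ω | (0 : ℝ≥0∞) < S n ω ∧ S n ω < ∞} :=
    (measurableSet_lt measurable_const (h.measurable_S n)).inter
      (measurableSet_lt (h.measurable_S n) measurable_const)
  have h2 := measure_inter_add_sdiff (μ := P) A hm
  rw [h1] at h2
  have h3 : P (A \ {ω | (0 : ℝ≥0∞) < S n ω ∧ S n ω < ∞}) = 0 := by
    rw [← ENNReal.add_right_inj (measure_ne_top P A), h2, add_zero]
  rw [ae_iff]
  refine measure_mono_null (fun ω hω => ?_) h3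
  simpa [hAdef] using hω

theorem ae_pos [IsFiniteMeasure P] (hK : IsKernel K) (h : IsJumpChain K P 𝓕 Y S I) (n : ℕ) :
    ∀ᵐ ω ∂P, 0 < S n ω := by
  filter_upwards [h.ae_pos_lt_top hK n, h.absorbed n] with ω h1 h2
  by_cases hq : totalRate K (Y n ω) = 0
  · rw [h2 hq]; exact ENNReal.zero_lt_top
  · exact (h1 hq).1

theorem ae_rate_ne_zero [IsFiniteMeasure P] (hK : IsKernel K) (h : IsJumpChain K P 𝓕 Y S I)
    (n : ℕ) : ∀ᵐ ω ∂P, S n ω < ∞ → rate K (Y n ω) (I n ω) ≠ 0 := by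
  have key : ∀ p, ∀ᵐ ω ∂P, rate K (Y n ω) p = 0 → ¬ (0 < S n ω ∧ S n ω < ∞ ∧ I n ω = p) := by
    intro p
    have hA : MeasurableSet[𝓕 n] {ω | rate K (Y n ω) p = 0} :=
      ((hK.measurable_rate p).comp (h.adapted n)) (measurableSet_singleton 0)
    have h1 := h.law n p 0 _ hA
    rw [setLIntegral_congr_fun (𝓕.le n _ hA) (g := fun _ => 0)
      (fun ω hω => by simp [show rate K (Y n ω) p = 0 from hω]), lintegral_zero] at h1
    rw [ae_iff]
    refine measure_mono_null (fun ω hω => ?_) h1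
    simpa using hω
  filter_upwards [ae_all_iff.2 key, h.ae_pos hK n] with ω h1 h2 h3 h4
  exact h1 _ h4 ⟨h2, h3, rfl⟩

theorem ae_isJumpPath [IsFiniteMeasure P] (hK : IsKernel K) (h : IsJumpChain K P 𝓕 Y S I) :
    ∀ᵐ ω ∂P, IsJumpPath K (fun n => Y n ω) (fun n => S n ω) (fun n => I n ω) := by
  filter_upwards [h.ae_isFinite, ae_all_iff.2 (h.ae_pos hK), ae_all_iff.2 (h.ae_rate_ne_zero hK),
    ae_all_iff.2 h.step] with ω h1 h2 h3 h4
  exact ⟨h1, h2, h3, h4⟩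

theorem lintegral_Ioi_exp_neg_mul {c : ℝ} (hc : 0 < c) :
    ∫⁻ s in Ioi (0 : ℝ), ENNReal.ofReal (Real.exp (-(c * s))) = ENNReal.ofReal c⁻¹ := by
  have e : ∀ s : ℝ, -(c * s) = (-c) * s := fun s => by ring
  simp only [e]
  rw [← ofReal_integral_eq_lintegral_ofReal]
  · rw [integral_exp_mul_Ioi (by linarith)]
    simp [neg_div_neg_eq]
  · exact integrableOn_exp_mul_Ioi (by linarith) 0
  · exact ae_of_all _ fun s => (Real.exp_pos _).le

/-- An exponential time of parameter `q` has mean `1 / q`: layer-cake formula, then Tonelli and the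
integral of `exp (-q s)`. -/
theorem setLIntegral_time_le [IsFiniteMeasure P] (hK : IsKernel K)
    (h : IsJumpChain K P 𝓕 Y S I) {n : ℕ} {A : Set Ω}
    (hA : MeasurableSet[𝓕 n] A) (hA0 : ∀ ω ∈ A, totalRate K (Y n ω) ≠ 0) :
    ∫⁻ ω in A, S n ω ∂P ≤ ∫⁻ ω in A, (totalRate K (Y n ω))⁻¹ ∂P := by
  have hA' : MeasurableSet A := 𝓕.le n _ hA
  have hq := hK.measurable_totalRate.comp (h.measurable_Y n)
  have hS := h.measurable_S n
  simp only [Function.comp_def] at hq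
  have hfin : ∀ᵐ ω ∂P, ω ∈ A → S n ω = ENNReal.ofReal (S n ω).toReal := by
    filter_upwards [h.ae_pos_lt_top hK n] with ω h1 hω
    rw [ENNReal.ofReal_toReal (h1 (hA0 ω hω)).2.ne]
  rw [setLIntegral_congr_fun_ae hA' hfin,
    lintegral_eq_lintegral_meas_lt (P.restrict A) (ae_of_all _ fun ω => ENNReal.toReal_nonneg)
      hS.ennreal_toReal.aemeasurable]
  calc ∫⁻ s in Ioi (0 : ℝ), (P.restrict A) {ω | s < (S n ω).toReal}
      ≤ ∫⁻ s in Ioi (0 : ℝ), ∫⁻ ω in A,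
          ENNReal.ofReal (Real.exp (-((totalRate K (Y n ω)).toReal * s))) ∂P := by
        refine setLIntegral_mono' measurableSet_Ioi fun s hs => ?_
        have hs0 : (0 : ℝ) ≤ s := le_of_lt hs
        have h1 := h.measure_inter_lt hK hA hA0 s.toNNReal
        rw [Real.coe_toNNReal s hs0] at h1
        rw [← h1, Measure.restrict_apply (measurableSet_lt measurable_const hS.ennreal_toReal),
          inter_comm]
        refine measure_mono (inter_subset_inter_right _ fun ω hω => ?_)
        have hω' : s < (S n ω).toReal := hω
        have ht : S n ω ≠ ∞ := by
          intro ht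
          rw [ht, ENNReal.toReal_top] at hω'
          linarith
        refine ⟨?_, ht.lt_top⟩
        rw [← ENNReal.ofReal_toReal ht]
        exact (ENNReal.ofReal_lt_ofReal_iff (hs0.trans_lt hω')).2 hω'
    _ = ∫⁻ ω in A, (∫⁻ s in Ioi (0 : ℝ),
          ENNReal.ofReal (Real.exp (-((totalRate K (Y n ω)).toReal * s)))) ∂P := by
        refine lintegral_lintegral_swap (Measurable.aemeasurable ?_)
        have hq2 : Measurable fun p : ℝ × Ω => totalRate K (Y n p.2) := hq.comp measurable_snd
        exact ENNReal.measurable_ofReal.comp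
          (Real.measurable_exp.comp (hq2.ennreal_toReal.mul measurable_fst).neg)
    _ = ∫⁻ ω in A, (totalRate K (Y n ω))⁻¹ ∂P := by
        refine setLIntegral_congr_fun_ae hA' ?_
        filter_upwards [h.ae_isFinite] with ω hf hω
        have hpos := ENNReal.toReal_pos (hA0 ω hω) ((hf n).totalRate_ne_top K)
        rw [lintegral_Ioi_exp_neg_mul hpos, ENNReal.ofReal_inv_of_pos hpos,
          ENNReal.ofReal_toReal ((hf n).totalRate_ne_top K)]

theorem setLIntegral_pairRate_div (hK : IsKernel K) (h : IsJumpChain K P 𝓕 Y S I) {n : ℕ}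
    {A : Set Ω} (hA : MeasurableSet[𝓕 n] A) (θ θ' : ℝ) :
    ∫⁻ ω in A, pairRate K θ θ' (Y n ω) / totalRate K (Y n ω) ∂P ≤
      P (A ∩ {ω | S n ω < ∞ ∧ IsPairIn θ θ' (Y n ω) (I n ω)}) := by
  classical
  have hA' : MeasurableSet A := 𝓕.le n _ hA
  have hq := hK.measurable_totalRate.comp (h.measurable_Y n)
  have hB : ∀ p, MeasurableSet[𝓕 n] {ω | IsPairIn θ θ' (Y n ω) p} := fun p =>
    h.adapted n (measurableSet_isPairIn θ θ' p)
  calc ∫⁻ ω in A, pairRate K θ θ' (Y n ω) / totalRate K (Y n ω) ∂P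
      = ∫⁻ ω in A, ∑' p, {ω | IsPairIn θ θ' (Y n ω) p}.indicator
          (fun ω => rate K (Y n ω) p / totalRate K (Y n ω)) ω ∂P := by
        refine lintegral_congr fun ω => ?_
        rw [pairRate, div_eq_mul_inv, ← ENNReal.tsum_mul_right]
        refine tsum_congr fun p => ?_
        simp only [indicator_apply, mem_ofPred_eq, ite_mul, zero_mul, div_eq_mul_inv]
    _ = ∑' p, ∫⁻ ω in A, {ω | IsPairIn θ θ' (Y n ω) p}.indicator
          (fun ω => rate K (Y n ω) p / totalRate K (Y n ω)) ω ∂P := by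
        refine lintegral_tsum fun p => ?_
        exact ((((hK.measurable_rate p).comp (h.measurable_Y n)).div hq).indicator
          (𝓕.le n _ (hB p))).aemeasurable
    _ = ∑' p, P ((A ∩ {ω | IsPairIn θ θ' (Y n ω) p}) ∩
          {ω | ((0 : ℝ≥0) : ℝ≥0∞) < S n ω ∧ S n ω < ∞ ∧ I n ω = p}) := by
        refine tsum_congr fun p => ?_
        rw [h.law n p 0 _ (hA.inter (hB p)), lintegral_indicator (𝓕.le n _ (hB p)),
          Measure.restrict_restrict (𝓕.le n _ (hB p)), inter_comm A]
        simp
    _ = P (⋃ p, (A ∩ {ω | IsPairIn θ θ' (Y n ω) p}) ∩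
          {ω | ((0 : ℝ≥0) : ℝ≥0∞) < S n ω ∧ S n ω < ∞ ∧ I n ω = p}) := by
        rw [measure_iUnion]
        · intro p q hpq
          refine disjoint_left.2 ?_
          rintro ω ⟨-, -, -, h1⟩ ⟨-, -, -, h2⟩
          exact hpq (h1.symm.trans h2)
        · exact fun p => (hA'.inter (𝓕.le n _ (hB p))).inter (h.measurableSet_event n 0 p)
    _ ≤ _ := by
        refine measure_mono (iUnion_subset fun p => ?_)
        rintro ω ⟨⟨h1, h2⟩, -, h3, rfl⟩
        exact ⟨h1, h3, h2⟩

/-- The total rate `q` cancels: the mean waiting time is at most `1 / q`, and the next coagulation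
is of the required type with conditional probability `pairRate / q ≥ r / q`. Thus time is converted
into a number of coagulations. -/
theorem mul_setLIntegral_time_le [IsFiniteMeasure P] (hK : IsKernel K)
    (h : IsJumpChain K P 𝓕 Y S I) (n : ℕ) {B : Set Configuration} (hB : MeasurableSet B)
    {θ θ' : ℝ} {r : ℝ≥0∞} (hr : r ≠ 0)
    (hrB : ∀ x ∈ B, x.IsFinite → r ≤ pairRate K θ θ' x) :
    r * ∫⁻ ω in Y n ⁻¹' B, S n ω ∂P ≤
      P (Y n ⁻¹' B ∩ {ω | S n ω < ∞ ∧ IsPairIn θ θ' (Y n ω) (I n ω)}) := by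
  set A := Y n ⁻¹' B ∩ {ω | totalRate K (Y n ω) ≠ 0} with hAdef
  have hA : MeasurableSet[𝓕 n] A :=
    (h.adapted n hB).inter (h.measurableSet_totalRate_ne_zero hK n)
  have hsub : (Y n ⁻¹' B : Set Ω) =ᵐ[P] A := by
    filter_upwards [h.ae_isFinite] with ω hf
    refine propext ⟨fun hω => ⟨hω, ?_⟩, fun hω => hω.1⟩
    have h1 := (hrB _ hω (hf n)).trans (pairRate_le_totalRate K θ θ' _)
    intro h0
    rw [h0, nonpos_iff_eq_zero] at h1
    exact hr h1
  have hq := hK.measurable_totalRate.comp (h.measurable_Y n)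
  rw [setLIntegral_congr hsub]
  calc r * ∫⁻ ω in A, S n ω ∂P ≤ r * ∫⁻ ω in A, (totalRate K (Y n ω))⁻¹ ∂P := by
        exact mul_le_mul_right (h.setLIntegral_time_le hK hA fun ω hω => hω.2) r
    _ = ∫⁻ ω in A, r * (totalRate K (Y n ω))⁻¹ ∂P :=
        (lintegral_const_mul _ hq.inv).symm
    _ ≤ ∫⁻ ω in A, pairRate K θ θ' (Y n ω) / totalRate K (Y n ω) ∂P := by
        refine setLIntegral_mono_ae' (𝓕.le n _ hA) ?_
        filter_upwards [h.ae_isFinite] with ω hf hω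
        rw [div_eq_mul_inv]
        gcongr
        exact hrB _ hω.1 (hf n)
    _ ≤ P (A ∩ {ω | S n ω < ∞ ∧ IsPairIn θ θ' (Y n ω) (I n ω)}) :=
        h.setLIntegral_pairRate_div hK hA θ θ'
    _ ≤ _ := measure_mono (inter_subset_inter_left _ inter_subset_left)

/-- The expected time spent in a set of configurations in which pairs of clusters with masses in
`[θ, θ')` coagulate at rate at least `r`, while the clusters of mass at least `θ'` carry a mass
less than `a`. -/
theorem occupation_le [IsProbabilityMeasure P] (hK : IsKernel K)
    (h : IsJumpChain K P 𝓕 Y S I) {B : Set Configuration} (hB : MeasurableSet B)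
    {θ θ' : ℝ} (hθ : θ' ≤ 2 * θ) {r a : ℝ≥0∞} (hr : r ≠ 0)
    (hrB : ∀ x ∈ B, x.IsFinite → r ≤ pairRate K θ θ' x)
    (haB : ∀ x ∈ B, massAbove θ' x < a) :
    ENNReal.ofReal (2 * θ) * (r * ∫⁻ ω, ∑' n, (Y n ⁻¹' B).indicator (S n) ω ∂P) ≤
      a + ENNReal.ofReal (2 * θ) := by
  classical
  have hBn : ∀ n, MeasurableSet (Y n ⁻¹' B) := fun n => h.measurable_Y n hB
  have hm : ∀ n, MeasurableSet
      (Y n ⁻¹' B ∩ {ω | S n ω < ∞ ∧ IsPairIn θ θ' (Y n ω) (I n ω)}) := by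
    intro n
    refine (hBn n).inter ((measurableSet_lt (h.measurable_S n) measurable_const).inter
      (?_ : MeasurableSet {ω | IsPairIn θ θ' (Y n ω) (I n ω)}))
    have e : {ω | IsPairIn θ θ' (Y n ω) (I n ω)} =
        ⋃ p, {ω | I n ω = p} ∩ {ω | IsPairIn θ θ' (Y n ω) p} := by
      ext ω; simp
    rw [e]
    exact MeasurableSet.iUnion fun p => (h.measurable_I n (measurableSet_singleton p)).inter
      (h.measurable_Y n (measurableSet_isPairIn θ θ' p))
  rw [lintegral_tsum fun n => ((h.measurable_S n).indicator (hBn n)).aemeasurable,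
    ← ENNReal.tsum_mul_left, ← ENNReal.tsum_mul_left]
  calc ∑' n, ENNReal.ofReal (2 * θ) * (r * ∫⁻ ω, (Y n ⁻¹' B).indicator (S n) ω ∂P)
      ≤ ∑' n, ∫⁻ ω, (Y n ⁻¹' B ∩ {ω | S n ω < ∞ ∧ IsPairIn θ θ' (Y n ω) (I n ω)}).indicator
          (fun _ => ENNReal.ofReal (2 * θ)) ω ∂P := by
        refine ENNReal.tsum_le_tsum fun n => ?_
        rw [lintegral_indicator_const (hm n), lintegral_indicator (hBn n)]
        gcongr
        exact h.mul_setLIntegral_time_le hK n hB hr hrB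
    _ = ∫⁻ ω, ∑' n, (Y n ⁻¹' B ∩ {ω | S n ω < ∞ ∧ IsPairIn θ θ' (Y n ω) (I n ω)}).indicator
          (fun _ => ENNReal.ofReal (2 * θ)) ω ∂P :=
        (lintegral_tsum fun n => (measurable_const.indicator (hm n)).aemeasurable).symm
    _ ≤ ∫⁻ _, a + ENNReal.ofReal (2 * θ) ∂P := by
        refine lintegral_mono_ae ?_
        filter_upwards [h.ae_isJumpPath hK] with ω hω
        refine le_trans (ENNReal.tsum_le_tsum fun n => ?_) (hω.tsum_pair_le hθ a)
        by_cases hn : ω ∈ Y n ⁻¹' B ∩ {ω | S n ω < ∞ ∧ IsPairIn θ θ' (Y n ω) (I n ω)}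
        · rw [indicator_of_mem hn, if_pos ⟨haB _ hn.1, hn.2⟩]
        · rw [indicator_of_notMem hn]
          exact zero_le
    _ = a + ENNReal.ofReal (2 * θ) := by simp

theorem occupation_level_le [IsProbabilityMeasure P] (hK : IsKernel K)
    (h : IsJumpChain K P 𝓕 Y S I) {θ θ' κ a a' : ℝ} (hθ : 0 < θ) (hθ' : θ ≤ θ')
    (hθ2 : θ' ≤ 2 * θ) (hκ : 0 < κ) (hKκ : ∀ u ∈ Ico θ θ', ∀ v ∈ Ico θ θ', κ ≤ K u v)
    (ha' : 0 ≤ a') (ha : 2 * θ' ≤ a - a') :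
    ∫⁻ ω, ∑' n, (Y n ⁻¹' {x | ENNReal.ofReal a ≤ massAbove θ x ∧
      massAbove θ' x < ENNReal.ofReal a'}).indicator (S n) ω ∂P ≤
      ENNReal.ofReal (8 * (a * (θ / (κ * (a - a') ^ 2)))) := by
  have hF : 0 < a - a' := by linarith
  have hr : 0 < κ * (a - a') ^ 2 / (4 * θ' ^ 2) := by
    have := hθ.trans_le hθ'
    positivity
  have hB : MeasurableSet {x : Configuration | ENNReal.ofReal a ≤ massAbove θ x ∧
      massAbove θ' x < ENNReal.ofReal a'} :=
    (measurableSet_le measurable_const (measurable_massAbove θ)).inter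
      (measurableSet_lt (measurable_massAbove θ') measurable_const)
  have h1 := h.occupation_le hK hB hθ2 (ENNReal.ofReal_pos.2 hr).ne'
    (fun x hx hf => le_pairRate hf hθ hθ' hκ.le hKκ ha ?_) (fun x hx => hx.2)
  · rw [← mul_assoc, ← ENNReal.ofReal_mul (by positivity), ← ENNReal.ofReal_add ha'
      (by positivity)] at h1
    have hpos : 0 < 2 * θ * (κ * (a - a') ^ 2 / (4 * θ' ^ 2)) := by positivity
    rw [mul_comm, ← ENNReal.le_div_iff_mul_le (Or.inl (ENNReal.ofReal_pos.2 hpos).ne')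
      (Or.inl ENNReal.ofReal_ne_top), ← ENNReal.ofReal_div_of_pos hpos] at h1
    refine h1.trans (ENNReal.ofReal_le_ofReal ?_)
    have hκF : 0 < κ * (a - a') ^ 2 := by positivity
    have e1 : (a' + 2 * θ) / (2 * θ * (κ * (a - a') ^ 2 / (4 * θ' ^ 2))) =
        (a' + 2 * θ) * (2 * θ' ^ 2 / θ) / (κ * (a - a') ^ 2) := by
      have := (hθ.trans_le hθ').ne'
      field_simp
      ring
    have e2 : 8 * (a * (θ / (κ * (a - a') ^ 2))) = a * (8 * θ) / (κ * (a - a') ^ 2) := by ring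
    rw [e1, e2]
    -- The constant `8` comes from `θ' ≤ 2 * θ`; the extra `2 * θ` in the count is absorbed by the
    -- gap `a - a' ≥ 2 * θ'`.
    have h2 : 2 * θ' ^ 2 / θ ≤ 8 * θ := by
      rw [div_le_iff₀ hθ]
      nlinarith
    have h3 : a' + 2 * θ ≤ a := by linarith
    have h4 : 0 ≤ 2 * θ' ^ 2 / θ := by positivity
    gcongr
    linarith
  · have e : ENNReal.ofReal a = ENNReal.ofReal a' + ENNReal.ofReal (a - a') := by
      rw [← ENNReal.ofReal_add ha' hF.le]; congr 1; ring
    have h2 := hx.1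
    rw [e] at h2
    exact (add_le_add_left hx.2.le _).trans h2

/-- If the clusters of mass at least `θ 0` initially carry mass at least `a 0`, it is unlikely
that, at a late time, the clusters of mass at least `θ J` carry mass less than `a J`. -/
theorem mul_measure_massAbove_lt_le [IsProbabilityMeasure P] (hK : IsKernel K)
    (h : IsJumpChain K P 𝓕 Y S I) {X : ℝ≥0 → Ω → Configuration}
    (hX : ∀ᵐ ω ∂P, ∀ (n : ℕ) (t : ℝ≥0), ∑ k ∈ Finset.range n, S k ω ≤ (t : ℝ≥0∞) →
      (t : ℝ≥0∞) < ∑ k ∈ Finset.range (n + 1), S k ω → X t ω = Y n ω)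
    {θ κ a : ℕ → ℝ} (hθ : ∀ j, 0 < θ j) (hθ' : ∀ j, θ j ≤ θ (j + 1))
    (hθ2 : ∀ j, θ (j + 1) ≤ 2 * θ j) (hκ : ∀ j, 0 < κ j)
    (hKκ : ∀ j, ∀ u ∈ Ico (θ j) (θ (j + 1)), ∀ v ∈ Ico (θ j) (θ (j + 1)), κ j ≤ K u v)
    (ha' : ∀ j, 0 ≤ a j) (J : ℕ) (ha : ∀ j < J, 2 * θ (j + 1) ≤ a j - a (j + 1)) (t : ℝ≥0) :
    t * P {ω | ENNReal.ofReal (a 0) ≤ massAbove (θ 0) (X 0 ω) ∧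
      massAbove (θ J) (X t ω) < ENNReal.ofReal (a J)} ≤
      ∑ j ∈ Finset.range J,
        ENNReal.ofReal (8 * (a j * (θ j / (κ j * (a j - a (j + 1)) ^ 2)))) := by
  set B : ℕ → Set Configuration := fun j => {x | ENNReal.ofReal (a j) ≤ massAbove (θ j) x ∧
      massAbove (θ (j + 1)) x < ENNReal.ofReal (a (j + 1))} with hBdef
  have hB : ∀ j, MeasurableSet (B j) := fun j =>
    (measurableSet_le measurable_const (measurable_massAbove _)).inter
      (measurableSet_lt (measurable_massAbove _) measurable_const)
  have hm : ∀ j, Measurable fun ω => ∑' n, (Y n ⁻¹' B j).indicator (S n) ω := fun j =>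
    Measurable.tsum fun n => (h.measurable_S n).indicator (h.measurable_Y n (hB j))
  set W : Ω → ℝ≥0∞ := fun ω => ∑ j ∈ Finset.range J, ∑' n, (Y n ⁻¹' B j).indicator (S n) ω
    with hW
  have hWm : Measurable W := Finset.measurable_fun_sum _ fun j _ => hm j
  calc t * P {ω | ENNReal.ofReal (a 0) ≤ massAbove (θ 0) (X 0 ω) ∧
        massAbove (θ J) (X t ω) < ENNReal.ofReal (a J)}
      ≤ t * P {ω | (t : ℝ≥0∞) ≤ W ω} := by
        refine mul_le_mul_right (measure_mono_ae ?_) _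
        filter_upwards [h.ae_isJumpPath hK, hX] with ω hω hXω hmem
        obtain ⟨n, hn1, hn2⟩ := hω.exists_sum_le_lt t
        have h0 : X 0 ω = Y 0 ω := hXω 0 0 (by simp) (by simpa using hω.pos 0)
        have hstart : ENNReal.ofReal (a 0) ≤ massAbove (θ 0) (Y 0 ω) := h0 ▸ hmem.1
        have hend : massAbove (θ J) (Y n ω) < ENNReal.ofReal (a J) := hXω n t hn1 hn2 ▸ hmem.2
        -- Without a bottleneck at step `k`, the targets would be met one after another up to level
        -- `J`, and by monotonicity in time still at step `n`, against `hend`. Hence all the time up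
        -- to `t` is spent in the sets `B j`.
        have key : ∀ k ∈ Finset.range (n + 1), ∃ j ∈ Finset.range J, Y k ω ∈ B j := by
          intro k hk
          by_contra! hcon
          have hall : ∀ j ≤ J, ENNReal.ofReal (a j) ≤ massAbove (θ j) (Y k ω) := by
            intro j
            induction j with
            | zero => exact fun _ => hstart.trans (hω.massAbove_mono _ k.zero_le)
            | succ j ih =>
              intro hj
              by_contra! hlt
              exact hcon j (Finset.mem_range.2 hj) ⟨ih (by omega), hlt⟩
          exact absurd ((hall J le_rfl).trans
            (hω.massAbove_mono _ (Nat.lt_succ_iff.1 (Finset.mem_range.1 hk)))) (not_le.2 hend)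
        calc (t : ℝ≥0∞) ≤ ∑ k ∈ Finset.range (n + 1), S k ω := hn2.le
          _ ≤ ∑ k ∈ Finset.range (n + 1), ∑ j ∈ Finset.range J,
                (Y k ⁻¹' B j).indicator (S k) ω := by
              refine Finset.sum_le_sum fun k hk => ?_
              obtain ⟨j, hj, hmem⟩ := key k hk
              refine le_trans (le_of_eq ?_) (Finset.single_le_sum
                (f := fun j => (Y k ⁻¹' B j).indicator (S k) ω) (fun _ _ => zero_le) hj)
              exact (indicator_of_mem (s := Y k ⁻¹' B j) hmem _).symm
          _ = ∑ j ∈ Finset.range J, ∑ k ∈ Finset.range (n + 1),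
                (Y k ⁻¹' B j).indicator (S k) ω := Finset.sum_comm
          _ ≤ W ω := Finset.sum_le_sum fun j _ => ENNReal.sum_le_tsum _
    _ ≤ ∫⁻ ω, W ω ∂P := mul_meas_ge_le_lintegral hWm _
    _ = ∑ j ∈ Finset.range J, ∫⁻ ω, ∑' n, (Y n ⁻¹' B j).indicator (S n) ω ∂P :=
        lintegral_finsetSum _ fun j _ => hm j
    _ ≤ _ := Finset.sum_le_sum fun j hj => h.occupation_level_le hK (hθ j) (hθ' j) (hθ2 j) (hκ j)
        (hKκ j) (ha' _) (ha j (Finset.mem_range.1 hj))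

end IsJumpChain

/-! ### From configurations to normalised measures. -/

theorem IsMarcusLushnikov.exists_isJumpChain {Ω : Type*} [mΩ : MeasurableSpace Ω]
    {K : ℝ → ℝ → ℝ} {P : Measure Ω} {X : ℝ≥0 → Ω → Configuration}
    (h : IsMarcusLushnikov K P X) :
    ∃ (𝓕 : Filtration ℕ mΩ) (Y : ℕ → Ω → Configuration) (S : ℕ → Ω → ℝ≥0∞)
      (I : ℕ → Ω → ℕ × ℕ), IsJumpChain K P 𝓕 Y S I ∧
      ∀ᵐ ω ∂P, ∀ (n : ℕ) (t : ℝ≥0), ∑ k ∈ Finset.range n, S k ω ≤ (t : ℝ≥0∞) →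
        (t : ℝ≥0∞) < ∑ k ∈ Finset.range (n + 1), S k ω → X t ω = Y n ω := by
  obtain ⟨𝓕, Y, S, I, h1, h2, h3, h4, h5, h6, h7, h8⟩ := h
  exact ⟨𝓕, Y, S, I, ⟨h1, h2, h3, h4, h5, h6, h7⟩, h8⟩

theorem IsMarcusLushnikov.ae_isFinite {Ω : Type*} [MeasurableSpace Ω]
    {K : ℝ → ℝ → ℝ} (hK : IsKernel K) {P : Measure Ω} [IsProbabilityMeasure P]
    {X : ℝ≥0 → Ω → Configuration} (h : IsMarcusLushnikov K P X) :
    ∀ᵐ ω ∂P, ∀ t, (X t ω).IsFinite ∧ massAbove 0 (X t ω) = massAbove 0 (X 0 ω) := by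
  obtain ⟨𝓕, Y, S, I, hc, hX⟩ := h.exists_isJumpChain
  filter_upwards [hc.ae_isJumpPath hK, hX] with ω hω hXω t
  obtain ⟨n, hn1, hn2⟩ := hω.exists_sum_le_lt t
  rw [hXω n t hn1 hn2, hXω 0 0 (by simp) (by simpa using hω.pos 0)]
  exact ⟨hω.isFinite n, hω.massAbove_zero_eq n⟩

theorem ae_pos_pointMeasure (x : Configuration) (c : ℝ≥0∞) :
    ∀ᵐ v ∂(c • pointMeasure x), 0 < v := by
  rw [ae_iff, Measure.smul_apply]
  have : {v : ℝ | ¬ 0 < v} = Iic 0 := by ext; simp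
  rw [this, pointMeasure_Iic_zero, smul_zero]

theorem integral_smul_pointMeasure (x : Configuration) (c : ℝ≥0∞) :
    ∫ v, v ∂(c • pointMeasure x) = (c * massAbove 0 x).toReal := by
  rw [integral_eq_lintegral_of_nonneg_ae
    ((ae_pos_pointMeasure x c).mono fun v hv => le_of_lt hv) aestronglyMeasurable_id,
    lintegral_smul_measure, lintegral_pointMeasure x ENNReal.measurable_ofReal, massAbove,
    smul_eq_mul]
  congr 2
  refine tsum_congr fun i => ?_
  simp only [indicator_apply, mem_Ioi, mem_Ici]
  split_ifs with h1 h2 h2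
  · rfl
  · linarith
  · rw [le_antisymm (not_lt.1 h1) h2, ENNReal.ofReal_zero]
  · rfl

theorem setIntegral_Iic_smul_pointMeasure (x : Configuration) (c : ℝ≥0∞) (b : ℝ) :
    ∫ v in Iic b, v ∂(c • pointMeasure x) =
      (c * ∑' i, (Ioc 0 b).indicator ENNReal.ofReal (x i)).toReal := by
  rw [integral_eq_lintegral_of_nonneg_ae (ae_restrict_of_ae
    ((ae_pos_pointMeasure x c).mono fun v hv => le_of_lt hv)) aestronglyMeasurable_id,
    ← lintegral_indicator measurableSet_Iic,
    lintegral_smul_measure, lintegral_pointMeasure x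
      (ENNReal.measurable_ofReal.indicator measurableSet_Iic),
    smul_eq_mul]
  congr 2
  refine tsum_congr fun i => ?_
  rw [indicator_indicator, Ioi_inter_Iic]

theorem setIntegral_Ioi_smul_pointMeasure (x : Configuration) (c : ℝ≥0∞) {g : ℝ → ℝ}
    (hg : Measurable g) (hg0 : ∀ v, 0 ≤ g v) :
    ∫ v in Ioi 0, g v ∂(c • pointMeasure x) =
      (c * ∑' i, (Ioi 0).indicator (fun v => ENNReal.ofReal (g v)) (x i)).toReal := by
  rw [integral_eq_lintegral_of_nonneg_ae (ae_of_all _ hg0) hg.aestronglyMeasurable,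
    ← lintegral_indicator measurableSet_Ioi,
    lintegral_smul_measure, lintegral_pointMeasure x
      (hg.ennreal_ofReal.indicator measurableSet_Ioi),
    smul_eq_mul]
  congr 2
  refine tsum_congr fun i => ?_
  rw [indicator_indicator, inter_self]

/-- Mass in large clusters is missing from the mass in small clusters. -/
theorem setIntegral_Iic_normalized_le {N : ℕ} (hN : N ≠ 0) {x x₀ : Configuration}
    (hx : x.IsFinite) (hmass : massAbove 0 x = massAbove 0 x₀) {θ b a : ℝ} (hb : b < θ)
    (ha : 0 ≤ a) (h : ENNReal.ofReal (N * a) ≤ massAbove θ x) :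
    ∫ v in Iic b, v ∂((N : ℝ≥0∞)⁻¹ • pointMeasure x) ≤
      ∫ v, v ∂((N : ℝ≥0∞)⁻¹ • pointMeasure x₀) - a := by
  rw [integral_smul_pointMeasure, setIntegral_Iic_smul_pointMeasure, ← hmass]
  have hfin := hx.massAbove_ne_top 0
  have h1 := (add_le_add_left h _).trans (massAbove_add_low_le hb x)
  have hlow : ∑' i, (Ioc 0 b).indicator ENNReal.ofReal (x i) ≠ ∞ :=
    ne_top_of_le_ne_top hfin (le_add_self.trans h1)
  have h2 := ENNReal.toReal_mono hfin h1
  have hN' : (0 : ℝ) < N := by positivity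
  rw [ENNReal.toReal_add ENNReal.ofReal_ne_top hlow, ENNReal.toReal_ofReal (by positivity)] at h2
  rw [ENNReal.toReal_mul, ENNReal.toReal_mul, ENNReal.toReal_inv, ENNReal.toReal_natCast,
    inv_mul_eq_div, inv_mul_eq_div, div_le_iff₀ hN', sub_mul, div_mul_cancel₀ _ hN'.ne']
  linarith

/-! ### Gelation from a ladder of levels. -/

section Family

variable {Ω : ℕ → Type*} [∀ N, MeasurableSpace (Ω N)]
  {P : ∀ N, Measure (Ω N)} [∀ N, IsProbabilityMeasure (P N)]
  {K : ℝ → ℝ → ℝ} {X : ∀ N, ℝ≥0 → Ω N → Configuration}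

/-- Weak convergence is tested on a continuous ramp `g` that vanishes below `ζ` and equals `1` from
`1` on. Its limiting integral is at least `μ (Ici 1)`, half of which is given up as tolerance, and
`ζ * g v ≤ v` on `v ≥ ζ` turns number into mass. -/
theorem tendsto_measure_massAbove_lt (hK : IsKernel K)
    (hX : ∀ N, IsMarcusLushnikov K (P N) (X N)) {μ : Measure ℝ} [IsFiniteMeasure μ]
    (hconv : TendstoWeaklyInProbability P (fun N ω => normalized N (X N) 0 ω) μ)
    (hμ : μ (Ici 1) ≠ 0) {ζ : ℝ} (hζ0 : 0 < ζ) (hζ1 : ζ < 1) :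
    Tendsto (fun N => P N {ω | massAbove ζ (X N 0 ω) <
      ENNReal.ofReal (N * (ζ * (μ.real (Ici 1) / 2)))}) atTop (𝓝 0) := by
  set g : ℝ → ℝ := fun v => max 0 (min 1 ((v - ζ) / (1 - ζ))) with hg
  have hgc : Continuous g := by
    refine continuous_const.max (continuous_const.min ?_)
    exact (continuous_id.sub continuous_const).div_const _
  have hg0 : ∀ v, 0 ≤ g v := fun v => le_max_left _ _
  have hg1 : ∀ v, g v ≤ 1 := fun v => max_le zero_le_one (min_le_left _ _)
  have hb : 0 < μ.real (Ici 1) := ENNReal.toReal_pos hμ (measure_ne_top _ _)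
  have hμg : μ.real (Ici 1) ≤ ∫ v in Ioi 0, g v ∂μ := by
    have hint : IntegrableOn g (Ioi 0) μ :=
      Integrable.of_bound hgc.aestronglyMeasurable 1
        (ae_of_all _ fun v => by rw [Real.norm_of_nonneg (hg0 v)]; exact hg1 v)
    calc μ.real (Ici 1) = ∫ v in Ici 1, (1 : ℝ) ∂μ := by simp
      _ ≤ ∫ v in Ici 1, g v ∂μ := by
          refine setIntegral_mono_on (by simp)
            (hint.mono_set fun v (hv : 1 ≤ v) => lt_of_lt_of_le one_pos hv) measurableSet_Ici ?_
          intro v (hv : 1 ≤ v)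
          have : 1 ≤ (v - ζ) / (1 - ζ) := by rw [le_div_iff₀ (by linarith)]; linarith
          exact (le_min le_rfl this).trans (le_max_right _ _)
      _ ≤ ∫ v in Ioi 0, g v ∂μ :=
          setIntegral_mono_set hint (ae_of_all _ hg0)
            (Eventually.of_forall fun v (hv : 1 ≤ v) => lt_of_lt_of_le one_pos hv)
  have key : ∀ v, ENNReal.ofReal ζ * (Ioi 0).indicator (fun v => ENNReal.ofReal (g v)) v ≤
      (Ici ζ).indicator ENNReal.ofReal v := by
    intro v
    by_cases hv : ζ ≤ v
    · rw [indicator_of_mem (mem_Ici.2 hv), indicator_of_mem (mem_Ioi.2 (hζ0.trans_le hv)),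
        ← ENNReal.ofReal_mul hζ0.le]
      exact ENNReal.ofReal_le_ofReal ((mul_le_of_le_one_right hζ0.le (hg1 v)).trans hv)
    · have : g v = 0 := by
        refine max_eq_left ((min_le_right _ _).trans ?_)
        exact div_nonpos_of_nonpos_of_nonneg (by linarith) (by linarith)
      simp [indicator_apply, this]
  refine tendsto_of_tendsto_of_tendsto_of_le_of_le' tendsto_const_nhds
    (hconv g hgc.continuousOn ⟨1, fun v _ => by rw [abs_of_nonneg (hg0 v)]; exact hg1 v⟩
      (μ.real (Ici 1) / 2) (by positivity)) (Eventually.of_forall fun _ => zero_le) ?_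
  filter_upwards [eventually_ge_atTop 1] with N hN
  refine measure_mono_ae ?_
  filter_upwards [(hX N).ae_isFinite hK] with ω hω hlt
  by_contra hcon
  have hcon : ¬ μ.real (Ici 1) / 2 ≤ |∫ v in Ioi 0, g v ∂(normalized N (X N) 0 ω) -
      ∫ v in Ioi 0, g v ∂μ| := hcon
  have hlt : massAbove ζ (X N 0 ω) < ENNReal.ofReal (N * (ζ * (μ.real (Ici 1) / 2))) := hlt
  have h1 := (abs_lt.1 (not_le.1 hcon)).1
  have h2 : μ.real (Ici 1) / 2 < ∫ v in Ioi 0, g v ∂(normalized N (X N) 0 ω) := by linarith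
  rw [normalized, zero_div, setIntegral_Ioi_smul_pointMeasure _ _ hgc.measurable hg0,
    ENNReal.toReal_mul, ENNReal.toReal_inv, ENNReal.toReal_natCast, inv_mul_eq_div,
    lt_div_iff₀ (by positivity)] at h2
  refine absurd hlt (not_lt.2 ?_)
  set w := ∑' i, (Ioi 0).indicator (fun v => ENNReal.ofReal (g v)) (X N 0 ω i) with hw
  calc ENNReal.ofReal (N * (ζ * (μ.real (Ici 1) / 2)))
      ≤ ENNReal.ofReal (ζ * w.toReal) := by
        apply ENNReal.ofReal_le_ofReal
        nlinarith
    _ ≤ ENNReal.ofReal ζ * w := by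
        rw [ENNReal.ofReal_mul hζ0.le]
        gcongr
        exact ENNReal.ofReal_toReal_le
    _ ≤ massAbove ζ (X N 0 ω) := by
        rw [hw, ← ENNReal.tsum_mul_left, massAbove]
        exact ENNReal.tsum_le_tsum fun i => key _

theorem stochasticGelation_of_levels (hK : IsKernel K)
    (hX : ∀ N, IsMarcusLushnikov K (P N) (X N)) {θ κ f : ℕ → ℝ} (hθ : ∀ j, 0 < θ j)
    (hθ' : ∀ j, θ j ≤ θ (j + 1)) (hθ2 : ∀ j, θ (j + 1) ≤ 2 * θ j)
    (hθj : ∀ j : ℕ, ((j - 1 : ℕ) : ℝ) < θ j) (hκ : ∀ j, 0 < κ j)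
    (hKκ : ∀ j, ∀ u ∈ Ico (θ j) (θ (j + 1)), ∀ v ∈ Ico (θ j) (θ (j + 1)), κ j ≤ K u v)
    (hf : ∀ j, 0 < f j) (hfs : Summable f) (hs : Summable fun j => θ j / (κ j * f j ^ 2))
    {A : ℝ} (hA : 0 < A)
    (hinit : Tendsto (fun N => P N {ω | massAbove (θ 0) (X N 0 ω) < ENNReal.ofReal (N * A)})
      atTop (𝓝 0)) :
    StochasticGelation P (fun N => normalized N (X N)) := by
  classical
  have hfpos : 0 < ∑' j, f j := hfs.tsum_pos (fun j => (hf j).le) 0 (hf 0)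
  -- With this `c` all the steps `c * f j` together use up `A / 2`, so every target keeps at least
  -- `A / 2`.
  set c : ℝ := A / (2 * ∑' j, f j) with hc
  have hc0 : 0 < c := by positivity
  set a : ℕ → ℝ := fun j => A - c * ∑ i ∈ Finset.range j, f i with ha
  have ha_diff : ∀ j, a j - a (j + 1) = c * f j := by
    intro j
    simp only [ha, Finset.sum_range_succ]
    ring
  have ha_ge : ∀ j, A / 2 ≤ a j := by
    intro j
    have h1 : ∑ i ∈ Finset.range j, f i ≤ ∑' j, f j := hfs.sum_le_tsum _ fun i _ => (hf i).le
    have h2 : c * ∑ i ∈ Finset.range j, f i ≤ A / 2 := by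
      calc c * ∑ i ∈ Finset.range j, f i ≤ c * ∑' j, f j := by gcongr
        _ = A / 2 := by rw [hc]; field_simp
    simp only [ha]
    linarith
  have ha_le : ∀ j, a j ≤ A := by
    intro j
    have : 0 ≤ c * ∑ i ∈ Finset.range j, f i :=
      mul_nonneg hc0.le (Finset.sum_nonneg fun i _ => (hf i).le)
    simp only [ha]
    linarith
  set D : ℝ := ∑' j, θ j / (κ j * f j ^ 2) with hD
  have hterm : ∀ j, 0 ≤ θ j / (κ j * f j ^ 2) := fun j =>
    div_nonneg (hθ j).le (mul_nonneg (hκ j).le (sq_nonneg _))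
  have hD0 : 0 ≤ D := tsum_nonneg hterm
  set T : ℝ := 8 * (A * D / c ^ 2) with hT
  have hT0 : 0 ≤ T := by positivity
  -- The expected bottleneck time is at most `T / N`, so at time `t / N` Markov's inequality leaves
  -- probability at most `T / (4 * T + 1) ≤ 1 / 4`.
  set t : ℝ≥0 := Real.toNNReal (4 * T + 1) with ht
  have ht' : (t : ℝ) = 4 * T + 1 := Real.coe_toNNReal _ (by positivity)
  -- The levels usable for a given `N` are those whose mass gap forces at least two clusters into
  -- the block. Each level becomes usable for large `N`; the cap `N` in `J` only makes the maximum
  -- exist.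
  let Q : ℕ → ℕ → Prop := fun N J => ∀ j < J, 2 * θ (j + 1) ≤ N * (c * f j)
  let J : ℕ → ℕ := fun N => Nat.findGreatest (Q N) N
  have hJ : ∀ N, Q N (J N) := fun N =>
    Nat.findGreatest_spec (P := Q N) N.zero_le fun j hj => absurd hj j.not_lt_zero
  have hJmono : Monotone J := fun M N hMN => by
    refine Nat.findGreatest_mono (fun L hL j hj => (hL j hj).trans ?_) hMN
    have := (hf j).le
    gcongr
  have hJtop : Tendsto J atTop atTop := by
    refine tendsto_atTop.2 fun L => ?_
    have : ∀ j ∈ Finset.range L, ∀ᶠ N : ℕ in atTop, 2 * θ (j + 1) ≤ N * (c * f j) := fun j _ =>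
      (tendsto_natCast_atTop_atTop.atTop_mul_const (mul_pos hc0 (hf j))).eventually_ge_atTop _
    filter_upwards [eventually_ge_atTop L, (Filter.eventually_all_finset _).2 this] with N hN h
    exact Nat.le_findGreatest hN fun j hj => h j (Finset.mem_range.2 hj)
  -- The cutoff `J N - 1` lies strictly below `θ (J N)` by `hθj`, so clusters above that level are
  -- not counted as small.
  refine ⟨fun N => J N - 1, fun M N h => Nat.sub_le_sub_right (hJmono h) 1,
    (tendsto_sub_atTop_nat 1).comp hJtop, A / 2, by positivity, ?_⟩
  refine lt_of_le_of_lt (sInf_le ⟨t, ?_, rfl⟩) ENNReal.coe_lt_top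
  refine lt_of_lt_of_le (b := (1 / 2 : ℝ≥0∞)) (by norm_num)
    (le_liminf_of_le (by isBoundedDefault) ?_)
  filter_upwards [eventually_ge_atTop 1,
    hinit.eventually_le_const (u := (1 / 4 : ℝ≥0∞)) (by norm_num)] with N hN hNinit
  have hN0 : (0 : ℝ) < N := by exact_mod_cast hN
  obtain ⟨𝓕, Y, S, I, hchain, hpath⟩ := (hX N).exists_isJumpChain
  have hE := hchain.mul_measure_massAbove_lt_le hK hpath (a := fun j => N * a j) hθ hθ' hθ2 hκ
    hKκ (fun j => mul_nonneg hN0.le (by linarith [ha_ge j])) (J N)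
    (fun j hj => by rw [← mul_sub, ha_diff]; exact hJ N j hj) (t / N)
  set E := {ω | ENNReal.ofReal (N * a 0) ≤ massAbove (θ 0) (X N 0 ω) ∧
      massAbove (θ (J N)) (X N (t / N) ω) < ENNReal.ofReal (N * a (J N))} with hEdef
  have hE4 : P N E ≤ 1 / 4 := by
    have hsum : ∑ j ∈ Finset.range (J N), ENNReal.ofReal
        (8 * (N * a j * (θ j / (κ j * (N * a j - N * a (j + 1)) ^ 2)))) ≤
        ENNReal.ofReal (T / N) := by
      have hnn : ∀ j, 0 ≤ 8 * (N * a j * (θ j / (κ j * (N * a j - N * a (j + 1)) ^ 2))) := by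
        intro j
        have h1 := ha_ge j
        have h2 := hκ j
        have h3 := hθ j
        have : 0 ≤ a j := by linarith
        positivity
      rw [← ENNReal.ofReal_sum_of_nonneg fun j _ => hnn j]
      apply ENNReal.ofReal_le_ofReal
      calc ∑ j ∈ Finset.range (J N),
            8 * (N * a j * (θ j / (κ j * (N * a j - N * a (j + 1)) ^ 2)))
          ≤ ∑ j ∈ Finset.range (J N), 8 * (A / c ^ 2) / N * (θ j / (κ j * f j ^ 2)) := by
            refine Finset.sum_le_sum fun j _ => ?_
            rw [← mul_sub, ha_diff]
            have h1 := (hf j).ne'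
            have h2 := (hκ j).ne'
            have e : 8 * (N * a j * (θ j / (κ j * (N * (c * f j)) ^ 2))) =
                8 * (a j / c ^ 2) / N * (θ j / (κ j * f j ^ 2)) := by
              field_simp
            rw [e]
            have := hterm j
            have := ha_le j
            gcongr
        _ = 8 * (A / c ^ 2) / N * ∑ j ∈ Finset.range (J N), θ j / (κ j * f j ^ 2) := by
            rw [Finset.mul_sum]
        _ ≤ 8 * (A / c ^ 2) / N * D := by
            gcongr
            exact hs.sum_le_tsum _ fun j _ => hterm j
        _ = T / N := by rw [hT]; ring
    have h1 := hE.trans hsum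
    have htN : ((t / N : ℝ≥0) : ℝ≥0∞) = ENNReal.ofReal ((4 * T + 1) / N) := by
      rw [← ENNReal.ofReal_coe_nnreal, NNReal.coe_div, ht', NNReal.coe_natCast]
    have hpos : 0 < (4 * T + 1) / N := by positivity
    rw [htN, mul_comm, ← ENNReal.le_div_iff_mul_le (Or.inl (ENNReal.ofReal_pos.2 hpos).ne')
      (Or.inl ENNReal.ofReal_ne_top), ← ENNReal.ofReal_div_of_pos hpos] at h1
    refine h1.trans ?_
    have : (1 / 4 : ℝ≥0∞) = ENNReal.ofReal (1 / 4) := by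
      rw [ENNReal.ofReal_div_of_pos (by norm_num)]; simp
    rw [this]
    apply ENNReal.ofReal_le_ofReal
    rw [div_div_div_cancel_right₀ hN0.ne', div_le_iff₀ (by positivity)]
    linarith
  set G := {ω | ∫ v in Iic ((J N - 1 : ℕ) : ℝ), v ∂(normalized N (X N) t ω) ≤
    ∫ v, v ∂(normalized N (X N) 0 ω) - A / 2} with hG
  -- Outside `G`, either the initial mass is too small or a bottleneck persists; each has
  -- probability at most `1 / 4`.
  have hcover : P N univ ≤
      P N (G ∪ ({ω | massAbove (θ 0) (X N 0 ω) < ENNReal.ofReal (N * A)} ∪ E)) := by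
    refine measure_mono_ae ?_
    filter_upwards [(hX N).ae_isFinite hK] with ω hω _
    by_cases h1 : massAbove (θ 0) (X N 0 ω) < ENNReal.ofReal (N * A)
    · exact Or.inr (Or.inl h1)
    by_cases h2 : massAbove (θ (J N)) (X N (t / N) ω) < ENNReal.ofReal (N * a (J N))
    · refine Or.inr (Or.inr ⟨?_, h2⟩)
      have : a 0 = A := by simp [ha]
      rw [this]
      exact not_lt.1 h1
    · refine Or.inl ?_
      change ∫ v in Iic ((J N - 1 : ℕ) : ℝ), v ∂((N : ℝ≥0∞)⁻¹ • pointMeasure (X N (t / N) ω)) ≤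
        ∫ v, v ∂((N : ℝ≥0∞)⁻¹ • pointMeasure (X N (0 / N) ω)) - A / 2
      rw [zero_div]
      refine setIntegral_Iic_normalized_le (by omega) (hω _).1 (hω _).2 (hθj (J N))
        (by positivity) (le_trans (ENNReal.ofReal_le_ofReal ?_) (not_lt.1 h2))
      have := ha_ge (J N)
      gcongr
  rw [measure_univ] at hcover
  have h1 : (1 : ℝ≥0∞) ≤ P N G + (1 / 4 + 1 / 4) :=
    hcover.trans ((measure_union_le _ _).trans (add_le_add_right
      ((measure_union_le _ _).trans (add_le_add hNinit hE4)) _))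
  have h2 : (1 / 4 + 1 / 4 : ℝ≥0∞) = 1 / 2 := by
    rw [ENNReal.div_add_div_same, ENNReal.div_eq_div_iff] <;> norm_num
  rw [h2] at h1
  have h3 : (1 / 2 + 1 / 2 : ℝ≥0∞) ≤ P N G + 1 / 2 := by rwa [ENNReal.add_halves]
  exact ENNReal.le_of_add_le_add_right (by norm_num) h3

end Family

/-! ### Dyadic blocks and the concrete criteria. -/

theorem pos_of_mem_block {j : ℕ} {x : ℝ} (hx : x ∈ block j) : 0 < x :=
  lt_of_lt_of_le (by positivity) hx.1

theorem pow_mem_block (j : ℕ) : (2 : ℝ) ^ j ∈ block j :=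
  ⟨le_rfl, pow_lt_pow_right₀ one_lt_two j.lt_succ_self⟩

theorem IsKernel.blockInf_le {K : ℝ → ℝ → ℝ} (hK : IsKernel K) {j : ℕ} {x y : ℝ}
    (hx : x ∈ block j) (hy : y ∈ block j) : blockInf K j ≤ K x y := by
  refine ciInf_le (f := fun p : ↥(block j ×ˢ block j) => K p.1.1 p.1.2) ⟨0, ?_⟩ ⟨(x, y), hx, hy⟩
  rintro _ ⟨⟨p, hp⟩, rfl⟩
  exact hK.nonneg _ _ (pos_of_mem_block hp.1) (pos_of_mem_block hp.2)

theorem le_blockInf {K : ℝ → ℝ → ℝ} {j : ℕ} {c : ℝ}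
    (h : ∀ x ∈ block j, ∀ y ∈ block j, c ≤ K x y) : c ≤ blockInf K j := by
  have : Nonempty ↥(block j ×ˢ block j) := ⟨⟨(2 ^ j, 2 ^ j), pow_mem_block j, pow_mem_block j⟩⟩
  exact le_ciInf fun p => h _ p.2.1 _ p.2.2

theorem IsKernel.exists_lower_bound_near_one {K : ℝ → ℝ → ℝ} (hK : IsKernel K)
    (h1 : 0 < K 1 1) : ∃ ζ : ℝ, 1 / 2 ≤ ζ ∧ ζ < 1 ∧
      ∀ u ∈ Ico ζ 1, ∀ v ∈ Ico ζ 1, K 1 1 / 2 ≤ K u v := by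
  have hc : ContinuousAt (Function.uncurry K) (1, 1) :=
    hK.continuousOn.continuousAt (prod_mem_nhds (Ioi_mem_nhds one_pos) (Ioi_mem_nhds one_pos))
  have hev := hc.eventually (lt_mem_nhds (show K 1 1 / 2 < Function.uncurry K (1, 1) from
    half_lt_self h1))
  obtain ⟨ε, hε, hball⟩ := Metric.eventually_nhds_iff.1 hev
  refine ⟨max (1 / 2) (1 - ε / 2), le_max_left _ _, max_lt (by norm_num) (by linarith), ?_⟩
  have hd : ∀ u ∈ Ico (max (1 / 2) (1 - ε / 2)) 1, dist u 1 < ε := by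
    intro u hu
    have := (le_max_right _ _).trans hu.1
    rw [Real.dist_eq, abs_lt]
    constructor <;> linarith [hu.2]
  intro u hu v hv
  exact (hball (y := (u, v)) (by rw [Prod.dist_eq]; exact max_lt (hd u hu) (hd v hv))).le

section Family

variable {Ω : ℕ → Type*} [∀ N, MeasurableSpace (Ω N)]
  {P : ∀ N, Measure (Ω N)} [∀ N, IsProbabilityMeasure (P N)]
  {K : ℝ → ℝ → ℝ} {X : ∀ N, ℝ≥0 → Ω N → Configuration}
  {μ : Measure ℝ} [IsFiniteMeasure μ]

theorem stochasticGelation_of_blockInf (hK : IsKernel K)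
    (hX : ∀ N, IsMarcusLushnikov K (P N) (X N))
    (hconv : TendstoWeaklyInProbability P (fun N ω => normalized N (X N) 0 ω) μ)
    (hmass : 0 < massGeOne μ) {f : ℕ → ℝ} (hf : ∀ j, 0 < f j) (hfs : Summable f)
    (hB : ∀ j, 0 < blockInf K j) (hs : Summable fun j => 2 ^ j / (blockInf K j * f j ^ 2)) :
    StochasticGelation P (fun N => normalized N (X N)) := by
  have hμ : μ (Ici 1) ≠ 0 := by
    intro h0
    rw [massGeOne, setLIntegral_measure_zero _ _ h0] at hmass
    exact hmass.false
  have h11 : 0 < K 1 1 := (hB 0).trans_le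
    (hK.blockInf_le (by simpa using pow_mem_block 0) (by simpa using pow_mem_block 0))
  obtain ⟨ζ, hζ, hζ1, hKζ⟩ := hK.exists_lower_bound_near_one h11
  have hζ0 : 0 < ζ := by linarith
  have hb : 0 < μ.real (Ici 1) := ENNReal.toReal_pos hμ (measure_ne_top _ _)
  -- Level `0` is `ζ` and level `j + 1` is `2 ^ j`. The bound `ζ ≥ 1 / 2` keeps consecutive ratios
  -- at most `2`, and continuity of the kernel at `(1, 1)` supplies the rate on `[ζ, 1)`. The value
  -- `1` prepended to `f` is arbitrary.
  refine stochasticGelation_of_levels hK hX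
    (θ := fun j => Nat.casesOn j ζ fun i => 2 ^ i)
    (κ := fun j => Nat.casesOn j (K 1 1 / 2) fun i => blockInf K i)
    (f := fun j => Nat.casesOn j 1 f) ?_ ?_ ?_ ?_ ?_ ?_ ?_ ?_ ?_
    (A := ζ * (μ.real (Ici 1) / 2)) (by positivity)
    (tendsto_measure_massAbove_lt hK hX hconv hμ hζ0 hζ1)
  · rintro (_ | j)
    · exact hζ0
    · exact pow_pos two_pos j
  · rintro (_ | j)
    · simpa using hζ1.le
    · exact pow_le_pow_right₀ one_le_two j.le_succ
  · rintro (_ | j)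
    · change (2 : ℝ) ^ 0 ≤ 2 * ζ
      linarith
    · exact (pow_succ' _ _).le
  · rintro (_ | j)
    · simpa using hζ0
    · simpa using (by exact_mod_cast Nat.lt_two_pow_self : (j : ℝ) < 2 ^ j)
  · rintro (_ | j)
    · exact half_pos h11
    · exact hB j
  · rintro (_ | j) u hu v hv
    · exact hKζ u (by simpa using hu) v (by simpa using hv)
    · exact hK.blockInf_le hu hv
  · rintro (_ | j)
    · exact one_pos
    · exact hf j
  · exact (summable_nat_add_iff 1).1 hfs
  · exact (summable_nat_add_iff 1).1 hs

/-- A finite supremum `s j` forces the kernel to be positive on the block, with `blockInf K j ≥ 2 ^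
j / (s j * f j ^ 2)`; this passes from suprema in `ℝ≥0∞` to real summability. -/
theorem stochasticGelation_of_tsum_lt_top (hK : IsKernel K)
    (hX : ∀ N, IsMarcusLushnikov K (P N) (X N))
    (hconv : TendstoWeaklyInProbability P (fun N ω => normalized N (X N) 0 ω) μ)
    (hmass : 0 < massGeOne μ) {f : ℕ → ℝ} (hf : ∀ j, 0 < f j) (hfs : Summable f)
    (hs : ∑' j : ℕ, (⨆ x ∈ block j, ⨆ y ∈ block j,
        (2 : ℝ≥0∞) ^ j / ENNReal.ofReal (K x y * f j ^ 2)) < ∞) :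
    StochasticGelation P (fun N => normalized N (X N)) := by
  set s : ℕ → ℝ≥0∞ := fun j => ⨆ x ∈ block j, ⨆ y ∈ block j,
        (2 : ℝ≥0∞) ^ j / ENNReal.ofReal (K x y * f j ^ 2) with hs_def
  have hfin : ∀ j, s j ≠ ∞ := fun j => ENNReal.ne_top_of_tsum_ne_top hs.ne j
  have hle : ∀ j, ∀ x ∈ block j, ∀ y ∈ block j,
      (2 : ℝ≥0∞) ^ j / ENNReal.ofReal (K x y * f j ^ 2) ≤ s j := fun j x hx y hy =>
    le_iSup₂_of_le x hx (le_iSup₂_of_le y hy le_rfl)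
  have hpow : ∀ j : ℕ, (2 : ℝ≥0∞) ^ j = ENNReal.ofReal (2 ^ j) := fun j => by
    rw [ENNReal.ofReal_pow zero_le_two, ENNReal.ofReal_ofNat]
  have hpos : ∀ j, ∀ x ∈ block j, ∀ y ∈ block j, 0 < K x y := by
    intro j x hx y hy
    by_contra! h
    have h1 := hle j x hx y hy
    rw [ENNReal.ofReal_of_nonpos (mul_nonpos_of_nonpos_of_nonneg h (sq_nonneg _)),
      ENNReal.div_zero (by simp)] at h1
    exact hfin j (top_le_iff.1 h1)
  have hle' : ∀ j, ∀ x ∈ block j, ∀ y ∈ block j, 2 ^ j / (K x y * f j ^ 2) ≤ (s j).toReal := by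
    intro j x hx y hy
    have h0 : 0 < K x y * f j ^ 2 := mul_pos (hpos j x hx y hy) (pow_pos (hf j) 2)
    have h1 := hle j x hx y hy
    rw [hpow, ← ENNReal.ofReal_div_of_pos h0] at h1
    exact (ENNReal.ofReal_le_iff_le_toReal (hfin j)).1 h1
  have hspos : ∀ j, 0 < (s j).toReal := fun j =>
    lt_of_lt_of_le (div_pos (by positivity) (mul_pos (hpos j _ (pow_mem_block j) _
      (pow_mem_block j)) (pow_pos (hf j) 2))) (hle' j _ (pow_mem_block j) _ (pow_mem_block j))
  have hblock : ∀ j, 2 ^ j / ((s j).toReal * f j ^ 2) ≤ blockInf K j := by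
    refine fun j => le_blockInf fun x hx y hy => ?_
    have h1 := hle' j x hx y hy
    have h2 := hpos j x hx y hy
    have h3 := hf j
    rw [div_le_iff₀ (by positivity)] at h1
    rw [div_le_iff₀ (mul_pos (hspos j) (by positivity))]
    linarith
  have hB : ∀ j, 0 < blockInf K j := fun j =>
    lt_of_lt_of_le (div_pos (by positivity) (mul_pos (hspos j) (pow_pos (hf j) 2))) (hblock j)
  refine stochasticGelation_of_blockInf hK hX hconv hmass hf hfs hB ?_
  refine Summable.of_nonneg_of_le (fun j => ?_) (fun j => ?_) (ENNReal.summable_toReal hs.ne)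
  · exact div_nonneg (by positivity) (mul_nonneg (hB j).le (sq_nonneg _))
  · have h1 := hblock j
    have h3 := hf j
    rw [div_le_iff₀ (mul_pos (hspos j) (by positivity))] at h1
    rw [div_le_iff₀ (mul_pos (hB j) (by positivity))]
    linarith

theorem stochasticGelation_of_eventually_le_blockInf (hK : IsKernel K)
    (hX : ∀ N, IsMarcusLushnikov K (P N) (X N))
    (hconv : TendstoWeaklyInProbability P (fun N ω => normalized N (X N) 0 ω) μ)
    (hmass : 0 < massGeOne μ) {f κ : ℕ → ℝ} (hf : ∀ j, 0 < f j) (hfs : Summable f)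
    (hB : ∀ j, 0 < blockInf K j) (hκ : ∀ᶠ j in atTop, 0 < κ j ∧ κ j ≤ blockInf K j)
    (hs : Summable fun j => 2 ^ j / (κ j * f j ^ 2)) :
    StochasticGelation P (fun N => normalized N (X N)) := by
  refine stochasticGelation_of_blockInf hK hX hconv hmass hf hfs hB
    (Summable.of_norm_bounded_eventually_nat hs ?_)
  filter_upwards [hκ] with j hj
  have h1 := hf j
  have h2 := hB j
  have h3 := hj.1
  rw [Real.norm_of_nonneg (by positivity)]
  have := hj.2
  gcongr

theorem stochasticGelation_of_rpow_le_blockInf (hK : IsKernel K)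
    (hX : ∀ N, IsMarcusLushnikov K (P N) (X N))
    (hconv : TendstoWeaklyInProbability P (fun N ω => normalized N (X N) 0 ω) μ)
    (hmass : 0 < massGeOne μ) (hB : ∀ j, 0 < blockInf K j) {γ m : ℝ} (hγ : 1 < γ) (hm : 0 < m)
    (h : ∀ᶠ j : ℕ in atTop, (2 ^ j) ^ γ * m ≤ blockInf K j) :
    StochasticGelation P (fun N => normalized N (X N)) := by
  -- Chosen so that `2 ^ γ = 2 * p ^ 4`: with `f j = p⁻¹ ^ j` the square of `f` costs `p ^ 2` per
  -- step, and the terms still decay like `(p ^ 2)⁻¹ ^ j`.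
  set p : ℝ := 2 ^ ((γ - 1) / 4) with hp
  have hp1 : 1 < p := Real.one_lt_rpow one_lt_two (by linarith)
  have hp0 : 0 < p := one_pos.trans hp1
  have hpow : ∀ j : ℕ, ((2 : ℝ) ^ j) ^ γ = (2 * p ^ 4) ^ j := by
    intro j
    rw [← Real.rpow_natCast 2 j, ← Real.rpow_mul zero_le_two, mul_comm,
      Real.rpow_mul zero_le_two, Real.rpow_natCast]
    congr 1
    rw [hp, ← Real.rpow_natCast, ← Real.rpow_mul zero_le_two, ← Real.rpow_one_add' zero_le_two]
    · congr 1; push_cast; ring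
    · push_cast; linarith
  have hinv : ∀ q : ℝ, 1 < q → Summable fun j : ℕ => q⁻¹ ^ j := fun q hq =>
    summable_geometric_of_lt_one (by positivity) (inv_lt_one_of_one_lt₀ hq)
  refine stochasticGelation_of_eventually_le_blockInf hK hX hconv hmass (f := fun j => p⁻¹ ^ j)
    (κ := fun j => (2 ^ j) ^ γ * m) (fun j => by positivity) (hinv p hp1) hB ?_ ?_
  · filter_upwards [h] with j hj
    exact ⟨by positivity, hj⟩
  · have e : ∀ j : ℕ, (2 : ℝ) ^ j / ((2 ^ j) ^ γ * m * (p⁻¹ ^ j) ^ 2) = m⁻¹ * (p ^ 2)⁻¹ ^ j := by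
      intro j
      have e1 : (2 * p ^ 4) ^ j = 2 ^ j * (p ^ j) ^ 4 := by
        rw [mul_pow, ← pow_mul, ← pow_mul, mul_comm 4]
      rw [hpow, e1, inv_pow p j, inv_pow (p ^ 2) j, pow_right_comm p 2 j]
      field_simp
    simp only [e]
    exact (hinv _ (one_lt_pow₀ hp1 two_ne_zero)).mul_left _

/-- By symmetry one may take `x ≤ y`; two masses of the same dyadic block then have ratio `y / x` in
`[1, 2]`. -/
theorem IsKernel.rpow_mul_le_blockInf (hK : IsKernel K) {γ R : ℝ} (hγ : 0 < γ)
    (h : ∀ x y, R ≤ x → R ≤ y → K x y = x ^ γ * K 1 (y / x)) {j : ℕ} (hj : R ≤ 2 ^ j) :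
    (2 ^ j) ^ γ * ⨅ i : Icc (1 : ℝ) 2, K 1 i ≤ blockInf K j := by
  have hnn : ∀ i : Icc (1 : ℝ) 2, 0 ≤ K 1 i := fun i =>
    hK.nonneg _ _ one_pos (one_pos.trans_le i.2.1)
  have key : ∀ x ∈ block j, ∀ y ∈ block j, x ≤ y →
      (2 ^ j) ^ γ * ⨅ i : Icc (1 : ℝ) 2, K 1 i ≤ K x y := by
    intro x hx y hy hxy
    have hx0 := pos_of_mem_block hx
    have hmem : y / x ∈ Icc (1 : ℝ) 2 := by
      refine ⟨(one_le_div hx0).2 hxy, (div_le_iff₀ hx0).2 ?_⟩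
      have h1 := hy.2
      have h2 := hx.1
      rw [pow_succ'] at h1
      linarith
    rw [h x y (hj.trans hx.1) (hj.trans hy.1)]
    refine mul_le_mul (Real.rpow_le_rpow (by positivity) hx.1 hγ.le) ?_
      (Real.iInf_nonneg hnn) (by positivity)
    exact ciInf_le (f := fun i : Icc (1 : ℝ) 2 => K 1 i) ⟨0, by rintro _ ⟨i, rfl⟩; exact hnn i⟩
      ⟨y / x, hmem⟩
  refine le_blockInf fun x hx y hy => ?_
  rcases le_total x y with hxy | hxy
  · exact key x hx y hy hxy
  · rw [hK.symm x y (pos_of_mem_block hx) (pos_of_mem_block hy)]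
    exact key y hy x hx hxy

theorem eventually_le_two_pow (R : ℝ) : ∀ᶠ j : ℕ in atTop, R ≤ 2 ^ j :=
  (tendsto_pow_atTop_atTop_of_one_lt one_lt_two).eventually_ge_atTop R

/-- Scaling factors below `1` are allowed, so a pair can be blown up beyond `R` and compared with
both its images, `(x, y)` and `(1, y / x)`. Homogeneity thus extends to all masses, which makes
every block infimum positive in the homogeneous case. -/
theorem eq_rpow_mul_of_homogeneous {γ R : ℝ} (hR : 0 < R)
    (h : ∀ x y, R ≤ x → R ≤ y → ∀ c : ℝ, 0 < c → K (c * x) (c * y) = c ^ γ * K x y)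
    {x y : ℝ} (hx : 0 < x) (hy : 0 < y) : K x y = x ^ γ * K 1 (y / x) := by
  set c : ℝ := R / x + R / y with hc
  have hc0 : 0 < c := by positivity
  have hcx : R ≤ c * x := by
    have : c * x = R + R / y * x := by rw [hc]; field_simp
    rw [this]
    have : 0 < R / y * x := by positivity
    linarith
  have hcy : R ≤ c * y := by
    have : c * y = R / x * y + R := by rw [hc]; field_simp
    rw [this]
    have : 0 < R / x * y := by positivity
    linarith
  have h1 := h _ _ hcx hcy c⁻¹ (by positivity)
  have h2 := h _ _ hcx hcy (c * x)⁻¹ (by positivity)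
  rw [inv_mul_cancel_left₀ hc0.ne', inv_mul_cancel_left₀ hc0.ne'] at h1
  rw [inv_mul_cancel₀ (by positivity),
    show (c * x)⁻¹ * (c * y) = y / x by field_simp, mul_inv, Real.mul_rpow (by positivity)
    (by positivity)] at h2
  rw [h1, h2, ← mul_assoc, ← mul_assoc, mul_comm (x ^ γ), mul_assoc (c⁻¹ ^ γ),
    ← Real.mul_rpow hx.le (inv_pos.2 hx).le, mul_inv_cancel₀ hx.ne', Real.one_rpow, mul_one]

theorem stochasticGelation_of_mul_log_le (hK : IsKernel K)
    (hX : ∀ N, IsMarcusLushnikov K (P N) (X N))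
    (hconv : TendstoWeaklyInProbability P (fun N ω => normalized N (X N) 0 ω) μ)
    (hmass : 0 < massGeOne μ) (hB : ∀ j, 0 < blockInf K j) {ε R : ℝ} (hε : 0 < ε)
    (h : ∀ x y, R ≤ x → R ≤ y → min x y * Real.log (min x y) ^ (3 + ε) ≤ K x y) :
    StochasticGelation P (fun N => normalized N (X N)) := by
  have hlog : 0 < Real.log 2 := Real.log_pos one_lt_two
  have hsum : ∀ r : ℝ, 1 < r → Summable fun j : ℕ => ((j : ℝ) + 1) ^ (-r) := by
    intro r hr
    have := (summable_nat_add_iff 1).2 (Real.summable_nat_rpow.2 (by linarith : -r < -1))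
    simpa using this
  -- Summability of `f` needs an exponent above `1`, and its square costs twice that: `3 + ε - 2 *
  -- (1 + ε / 4) = 1 + ε / 2` is what remains. The factor `log 2 / 2` absorbs the change from `j` to
  -- `j + 1` for `j ≥ 1`.
  refine stochasticGelation_of_eventually_le_blockInf hK hX hconv hmass
    (f := fun j => ((j : ℝ) + 1) ^ (-(1 + ε / 4)))
    (κ := fun j => 2 ^ j * (Real.log 2 / 2 * ((j : ℝ) + 1)) ^ (3 + ε))
    (fun j => by positivity) (hsum _ (by linarith)) hB ?_ ?_
  · filter_upwards [eventually_le_two_pow R, eventually_ge_atTop 1] with j hj hj1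
    refine ⟨by positivity, le_blockInf fun x hx y hy => ?_⟩
    refine le_trans ?_ (h x y (hj.trans hx.1) (hj.trans hy.1))
    have hmin : (2 : ℝ) ^ j ≤ min x y := le_min hx.1 hy.1
    have hj1' : (1 : ℝ) ≤ j := by exact_mod_cast hj1
    have hl : Real.log 2 / 2 * ((j : ℝ) + 1) ≤ Real.log (min x y) := by
      have := Real.log_le_log (by positivity) hmin
      rw [Real.log_pow] at this
      nlinarith
    have hmin0 : 0 ≤ min x y := le_trans (by positivity) hmin
    gcongr
  · have e : ∀ j : ℕ, (2 : ℝ) ^ j / (2 ^ j * (Real.log 2 / 2 * ((j : ℝ) + 1)) ^ (3 + ε) *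
        (((j : ℝ) + 1) ^ (-(1 + ε / 4))) ^ 2) =
        ((Real.log 2 / 2) ^ (3 + ε))⁻¹ * ((j : ℝ) + 1) ^ (-(1 + ε / 2)) := by
      intro j
      have hj : (0 : ℝ) < (j : ℝ) + 1 := by positivity
      have e1 : ((j : ℝ) + 1) ^ (3 + ε) * (((j : ℝ) + 1) ^ (-(1 + ε / 4))) ^ 2 =
          ((j : ℝ) + 1) ^ (1 + ε / 2) := by
        rw [← Real.rpow_natCast (_ ^ _) 2, ← Real.rpow_mul hj.le, ← Real.rpow_add hj]
        congr 1
        push_cast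
        ring
      rw [Real.rpow_neg hj.le (1 + ε / 2), Real.mul_rpow (by positivity) hj.le, mul_assoc,
        mul_assoc, e1]
      field_simp
    simp only [e]
    exact (hsum _ (by linarith)).mul_left _

end Family

end Coagulation


theorem corollary2p1 {Ω : ℕ → Type*} [∀ N, MeasurableSpace (Ω N)]
    (P : ∀ N, Measure (Ω N)) [∀ N, IsProbabilityMeasure (P N)]
    (K : ℝ → ℝ → ℝ) (hK : Coagulation.IsKernel K)
    (X : ∀ N, ℝ≥0 → Ω N → Coagulation.Configuration)
    (hX : ∀ N, Coagulation.IsMarcusLushnikov K (P N) (X N))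
    (μ : Measure ℝ) [IsFiniteMeasure μ] (hμ : μ (Iic 0) = 0)
    (hconv : Coagulation.TendstoWeaklyInProbability P
      (fun N ω => Coagulation.normalized N (X N) 0 ω) μ)
    (hmass : 0 < Coagulation.massGeOne μ) :
    -- the general criterion (in `ℝ≥0∞`, so that a vanishing kernel gives the term `∞`)
    ((∃ f : ℕ → ℝ, (∀ j, 0 < f j) ∧ StrictAnti f ∧ Summable f ∧
        ∑' j : ℕ, (⨆ x ∈ Coagulation.block j, ⨆ y ∈ Coagulation.block j,
          (2 : ℝ≥0∞) ^ j / ENNReal.ofReal (K x y * f j ^ 2)) < ∞) →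
      Coagulation.StochasticGelation P (fun N => Coagulation.normalized N (X N))) ∧
    -- homogeneous kernels
    ((0 < ⨅ i : Icc (1 : ℝ) 2, K 1 i) →
      (∃ γ : ℝ, 1 < γ ∧ ∃ R : ℝ, 0 < R ∧ ∀ x y, R ≤ x → R ≤ y → ∀ c : ℝ, 0 < c →
        K (c * x) (c * y) = c ^ γ * K x y) →
      Coagulation.StochasticGelation P (fun N => Coagulation.normalized N (X N))) ∧
    -- kernels that are homogeneous at large masses only
    ((0 < ⨅ i : Icc (1 : ℝ) 2, K 1 i) →
      (∀ j, 0 < Coagulation.blockInf K j) →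
      (∃ γ : ℝ, 1 < γ ∧ ∃ R : ℝ, 0 < R ∧ ∀ x y, R ≤ x → R ≤ y →
        K x y = x ^ γ * K 1 (y / x)) →
      Coagulation.StochasticGelation P (fun N => Coagulation.normalized N (X N))) ∧
    -- kernels with a lower bound at large masses
    ((∀ j, 0 < Coagulation.blockInf K j) →
      (∃ ε : ℝ, 0 < ε ∧ ∃ R : ℝ, 0 < R ∧ ∀ x y, R ≤ x → R ≤ y →
        min x y * Real.log (min x y) ^ (3 + ε) ≤ K x y) →
      Coagulation.StochasticGelation P (fun N => Coagulation.normalized N (X N))) := by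
  refine ⟨?_, ?_, ?_, ?_⟩
  · rintro ⟨f, hf, -, hfs, hs⟩
    exact Coagulation.stochasticGelation_of_tsum_lt_top hK hX hconv hmass hf hfs hs
  · rintro hinf ⟨γ, hγ, R, hR, h⟩
    have hle : ∀ j : ℕ, (2 ^ j) ^ γ * ⨅ i : Icc (1 : ℝ) 2, K 1 i ≤ Coagulation.blockInf K j :=
      fun j => hK.rpow_mul_le_blockInf (R := 1) (by linarith)
        (fun x y hx hy => Coagulation.eq_rpow_mul_of_homogeneous hR h (one_pos.trans_le hx)
          (one_pos.trans_le hy)) (one_le_pow₀ one_le_two)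
    exact Coagulation.stochasticGelation_of_rpow_le_blockInf hK hX hconv hmass
      (fun j => lt_of_lt_of_le (by positivity) (hle j)) hγ hinf (Eventually.of_forall hle)
  · rintro hinf hB ⟨γ, hγ, R, -, h⟩
    exact Coagulation.stochasticGelation_of_rpow_le_blockInf hK hX hconv hmass hB hγ hinf
      ((Coagulation.eventually_le_two_pow R).mono fun j hj =>
        hK.rpow_mul_le_blockInf (by linarith) h hj)
  · rintro hB ⟨ε, hε, R, -, h⟩
    exact Coagulation.stochasticGelation_of_mul_log_le hK hX hconv hmass hB hε h
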